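/- Let $d\ge 2$ be an integer, let $p\ge q>1$ be real numbers, and put $$\alpha=\frac{2(p+1)}{pq-1},\qquad \beta=\frac{2(q+1)}{pq-1},\qquad H(x)=x^4-pq\,\alpha\beta\left(4x^2-2(\alpha+\beta)x+\alpha\beta\right).$$ Then the polynomial $H$ has a largest real root $x_0$. If $d<2+2x_0$, then the Lane--Emden system $$-\Delta u=|v|^{p-1}v,\qquad -\Delta v=|u|^{q-1}u\qquad\text{in }\mathbb R^d$$ has no positive stable classical solution, that is, there is no solution $(u,v)$ with $u,v\in C^2(\mathbb R^d)$, $u>0$ and $v>0$ in $\mathbb R^d$, that is stable in $\mathbb R^d$. Here $(u,v)$ is called stable in $\mathbb R^d$ if there exist two positive functions $\phi,\psi\in C^2(\mathbb R^d)$ such that $$-\Delta\phi\ge p|v|^{p-1}\psi,\qquad -\Delta\psi\ge q|u|^{q-1}\phi\qquad\text{in }\mathbb R^d.$$ -/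

import Mathlib

open scoped Laplacian

namespace LaneEmden

/-- The pair `(u, v)` is a classical (that is, `C²`) solution on `ℝᵈ` of the system
`-Δu = |v|^(p-1) v`, `-Δv = |u|^(q-1) u`. -/
structure IsClassicalSolution {d : ℕ} (p q : ℝ) (u v : EuclideanSpace ℝ (Fin d) → ℝ) : Prop where
  contDiff_fst : ContDiff ℝ 2 u
  contDiff_snd : ContDiff ℝ 2 v
  eq_fst : ∀ x, -(Δ u x) = |v x| ^ (p - 1) * v x
  eq_snd : ∀ x, -(Δ v x) = |u x| ^ (q - 1) * u x

/-- The pair `(u, v)` is stable on the open set `Ω`: there are two positive functions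
`φ, ψ ∈ C²(Ω)` with `-Δφ ≥ p |v|^(p-1) ψ` and `-Δψ ≥ q |u|^(q-1) φ` in `Ω`. -/
def IsStableOn {d : ℕ} (p q : ℝ) (u v : EuclideanSpace ℝ (Fin d) → ℝ)
    (Ω : Set (EuclideanSpace ℝ (Fin d))) : Prop :=
  ∃ φ ψ : EuclideanSpace ℝ (Fin d) → ℝ,
    ContDiffOn ℝ 2 φ Ω ∧ ContDiffOn ℝ 2 ψ Ω ∧
    (∀ x ∈ Ω, 0 < φ x) ∧ (∀ x ∈ Ω, 0 < ψ x) ∧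
    (∀ x ∈ Ω, p * |v x| ^ (p - 1) * ψ x ≤ -(Δ φ x)) ∧
    (∀ x ∈ Ω, q * |u x| ^ (q - 1) * φ x ≤ -(Δ ψ x))

/-- The scaling exponent `α = 2(p+1)/(pq-1)`. -/
noncomputable def scalingAlpha (p q : ℝ) : ℝ := 2 * (p + 1) / (p * q - 1)

/-- The scaling exponent `β = 2(q+1)/(pq-1)`. -/
noncomputable def scalingBeta (p q : ℝ) : ℝ := 2 * (q + 1) / (p * q - 1)

/-- The quartic `H(x) = x⁴ - pqαβ (4x² - 2(α+β)x + αβ)`. -/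
noncomputable def quarticH (p q x : ℝ) : ℝ :=
  x ^ 4 - p * q * scalingAlpha p q * scalingBeta p q *
    (4 * x ^ 2 - 2 * (scalingAlpha p q + scalingBeta p q) * x
      + scalingAlpha p q * scalingBeta p q)

end LaneEmden

/-! Write `s + 1 = 2x/α` and `t + 1 = 2x/β`. Stability, tested with powers of the solution, is
combined with an interpolation argument and with scaling; `H(x) < 0` is exactly the condition under
which the stability estimate closes.

Multiplying the two stability inequalities by `γ²/φ` and `γ²/ψ`, and using the arithmetic-geometric
mean inequality to cancel `φ` and `ψ`, gives `√(pq) ∫ u^((q-1)/2) v^((p-1)/2) γ² ≤ ∫ |∇γ|²`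
(`IsPositiveStable.integral_le`). Take `γ = u^((s+1)/2) η^(n+1)` and `γ = v^((t+1)/2) η^(n+1)`. By
the equations, the gradient terms have leading parts `(s+1)²/(4s) ∫ v^p u^s η^(2n+2)` and
`(t+1)²/(4t) ∫ u^q v^t η^(2n+2)`. Both integrands interpolate between the two left-hand integrands,
so they are absorbed when `(s+1)²(t+1)² < 16 pq st`, that is, `H(x) < 0`. The errors involve
`u^(s+1)` and `v^(t+1)`; the pointwise comparison `v ≤ l u^((q+1)/(p+1))`
(`IsPositiveStable.exists_comparison`) leaves only the former.

This controls `∫ v^p u^s η^(2n+2)` and the gradient of `u^(s+1)` by `E = ∫ u^(s+1) η^(2n)`. The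
Sobolev inequality and a bound for `∫ u η^j` common to all solutions give `E ≤ K E^ρ` with `ρ < 1`,
so `E` is bounded independently of the solution (`IsPositiveStable.exists_uniform_bound`). Applied
to all rescalings of one solution, the bound fails as `R → ∞` if `d < αs + βp = 2x + 2`. Finally, `H
< 0` at points arbitrarily close to `x₀` from below (`exists_isGreatest_quarticH`), so a suitable
`x` exists whenever `d < 2 + 2x₀`. -/

namespace LaneEmden

open MeasureTheory Filter Topology Set

/-- The `i`-th partial derivative of `f`. -/
noncomputable def partialDeriv {d : ℕ} (i : Fin d) (f : EuclideanSpace ℝ (Fin d) → ℝ)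
    (x : EuclideanSpace ℝ (Fin d)) : ℝ :=
  fderiv ℝ f x (EuclideanSpace.single i 1)

/-- The inner product of the gradients of `f` and `g`. -/
noncomputable def gradInner {d : ℕ} (f g : EuclideanSpace ℝ (Fin d) → ℝ)
    (x : EuclideanSpace ℝ (Fin d)) : ℝ :=
  ∑ i, partialDeriv i f x * partialDeriv i g x

/-! ### Coordinate calculus for gradients and Laplacians. -/

section Calculus

variable {d : ℕ} {f g : EuclideanSpace ℝ (Fin d) → ℝ} {x : EuclideanSpace ℝ (Fin d)} {i : Fin d}

theorem gradInner_comm : gradInner f g x = gradInner g f x := by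
  simp only [gradInner, mul_comm]

theorem gradInner_self_nonneg : 0 ≤ gradInner f f x :=
  Finset.sum_nonneg fun _ _ => mul_self_nonneg _

theorem contDiff_partialDeriv (hf : ContDiff ℝ 2 f) (i : Fin d) :
    ContDiff ℝ 1 (partialDeriv i f) :=
  (hf.fderiv_right (m := 1) (by norm_num)).clm_apply contDiff_const

theorem continuous_partialDeriv (hf : ContDiff ℝ 1 f) (i : Fin d) :
    Continuous (partialDeriv i f) :=
  (hf.continuous_fderiv (by norm_num)).clm_apply continuous_const

theorem continuous_gradInner (hf : ContDiff ℝ 1 f) (hg : ContDiff ℝ 1 g) :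
    Continuous (gradInner f g) :=
  continuous_finsetSum _ fun i _ => (continuous_partialDeriv hf i).mul (continuous_partialDeriv hg i)

theorem laplacian_eq_sum_partialDeriv (hf : ContDiff ℝ 2 f) (x : EuclideanSpace ℝ (Fin d)) :
    Δ f x = ∑ i, partialDeriv i (partialDeriv i f) x := by
  rw [InnerProductSpace.laplacian_eq_iteratedFDeriv_orthonormalBasis f
    (EuclideanSpace.basisFun (Fin d) ℝ)]
  refine Finset.sum_congr rfl fun i _ => ?_
  rw [iteratedFDeriv_two_apply]
  have h : DifferentiableAt ℝ (fderiv ℝ f) x :=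
    ((hf.fderiv_right (m := 1) (by norm_num)).differentiable (by norm_num)) x
  simp only [partialDeriv, EuclideanSpace.basisFun_apply, Matrix.cons_val_zero,
    Matrix.cons_val_one]
  have h2 : partialDeriv i f = fun y => fderiv ℝ f y (EuclideanSpace.single i 1) := rfl
  rw [h2, fderiv_clm_apply h (differentiableAt_const _)]
  simp

theorem continuous_laplacian (hf : ContDiff ℝ 2 f) : Continuous (Δ f) := by
  rw [funext (laplacian_eq_sum_partialDeriv hf)]
  exact continuous_finsetSum _ fun i _ => continuous_partialDeriv (contDiff_partialDeriv hf i) i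

theorem partialDeriv_mul (hf : DifferentiableAt ℝ f x) (hg : DifferentiableAt ℝ g x) :
    partialDeriv i (fun y => f y * g y) x = f x * partialDeriv i g x + g x * partialDeriv i f x := by
  simp [partialDeriv, fderiv_fun_mul hf hg]

theorem partialDeriv_add (hf : DifferentiableAt ℝ f x) (hg : DifferentiableAt ℝ g x) :
    partialDeriv i (fun y => f y + g y) x = partialDeriv i f x + partialDeriv i g x := by
  simp [partialDeriv, fderiv_fun_add hf hg]

theorem partialDeriv_const_mul (c : ℝ) (hf : DifferentiableAt ℝ f x) :
    partialDeriv i (fun y => c * f y) x = c * partialDeriv i f x := by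
  simp [partialDeriv, fderiv_const_mul hf]

theorem partialDeriv_comp {F : ℝ → ℝ} {F' : ℝ} (hF : HasDerivAt F F' (f x))
    (hf : DifferentiableAt ℝ f x) :
    partialDeriv i (fun y => F (f y)) x = F' * partialDeriv i f x := by
  have := (hF.comp_hasFDerivAt x hf.hasFDerivAt).fderiv
  simp only [Function.comp_def] at this
  simp [partialDeriv, this]

theorem partialDeriv_rpow (a : ℝ) (h0 : f x ≠ 0) (hf : DifferentiableAt ℝ f x) :
    partialDeriv i (fun y => f y ^ a) x = a * f x ^ (a - 1) * partialDeriv i f x :=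
  partialDeriv_comp (F := fun t => t ^ a) (Real.hasDerivAt_rpow_const (Or.inl h0)) hf

theorem partialDeriv_pow (n : ℕ) (hf : DifferentiableAt ℝ f x) :
    partialDeriv i (fun y => f y ^ n) x = n * f x ^ (n - 1) * partialDeriv i f x :=
  partialDeriv_comp (F := fun t => t ^ n) (hasDerivAt_pow n _) hf

theorem gradInner_mul_right {h : EuclideanSpace ℝ (Fin d) → ℝ} (hf : DifferentiableAt ℝ f x)
    (hg : DifferentiableAt ℝ g x) :
    gradInner h (fun y => f y * g y) x = f x * gradInner h g x + g x * gradInner h f x := by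
  simp only [gradInner, partialDeriv_mul hf hg, Finset.mul_sum, ← Finset.sum_add_distrib]
  exact Finset.sum_congr rfl fun i _ => by ring

theorem gradInner_rpow_right {h : EuclideanSpace ℝ (Fin d) → ℝ} (a : ℝ) (h0 : f x ≠ 0)
    (hf : DifferentiableAt ℝ f x) :
    gradInner h (fun y => f y ^ a) x = a * f x ^ (a - 1) * gradInner h f x := by
  simp only [gradInner, partialDeriv_rpow a h0 hf, Finset.mul_sum]
  exact Finset.sum_congr rfl fun i _ => by ring

theorem laplacian_fun_mul (hf : ContDiff ℝ 2 f) (hg : ContDiff ℝ 2 g)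
    (x : EuclideanSpace ℝ (Fin d)) :
    Δ (fun y => f y * g y) x = f x * Δ g x + 2 * gradInner f g x + g x * Δ f x := by
  have df : Differentiable ℝ f := hf.differentiable (by norm_num)
  have dg : Differentiable ℝ g := hg.differentiable (by norm_num)
  rw [laplacian_eq_sum_partialDeriv (hf.mul hg), laplacian_eq_sum_partialDeriv hf,
    laplacian_eq_sum_partialDeriv hg]
  simp only [gradInner, Finset.mul_sum, ← Finset.sum_add_distrib]
  refine Finset.sum_congr rfl fun i _ => ?_
  have dpf := (contDiff_partialDeriv hf i).differentiable (by norm_num)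
  have dpg := (contDiff_partialDeriv hg i).differentiable (by norm_num)
  have h1 : partialDeriv i (fun y => f y * g y) =
      fun y => f y * partialDeriv i g y + g y * partialDeriv i f y :=
    funext fun y => partialDeriv_mul (df y) (dg y)
  rw [h1, partialDeriv_add ((df x).fun_mul (dpg x)) ((dg x).fun_mul (dpf x)),
    partialDeriv_mul (df x) (dpg x), partialDeriv_mul (dg x) (dpf x)]
  ring

theorem laplacian_fun_comp {F F' F'' : ℝ → ℝ} (hf : ContDiff ℝ 2 f)
    (hFf : ContDiff ℝ 2 (fun y => F (f y)))
    (hF : ∀ y, HasDerivAt F (F' (f y)) (f y)) (hF' : ∀ y, HasDerivAt F' (F'' (f y)) (f y))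
    (x : EuclideanSpace ℝ (Fin d)) :
    Δ (fun y => F (f y)) x = F' (f x) * Δ f x + F'' (f x) * gradInner f f x := by
  have df : Differentiable ℝ f := hf.differentiable (by norm_num)
  rw [laplacian_eq_sum_partialDeriv hFf, laplacian_eq_sum_partialDeriv hf]
  simp only [gradInner, Finset.mul_sum, ← Finset.sum_add_distrib]
  refine Finset.sum_congr rfl fun i _ => ?_
  have dpf := (contDiff_partialDeriv hf i).differentiable (by norm_num)
  have h1 : partialDeriv i (fun y => F (f y)) = fun y => F' (f y) * partialDeriv i f y :=
    funext fun y => partialDeriv_comp (hF y) (df y)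
  rw [h1, partialDeriv_mul (f := fun y => F' (f y)) ((hF' x).differentiableAt.comp x (df x)) (dpf x),
    partialDeriv_comp (hF' x) (df x)]
  ring

theorem contDiff_rpow {n : WithTop ℕ∞} (hf : ContDiff ℝ n f) (h0 : ∀ y, 0 < f y) (a : ℝ) :
    ContDiff ℝ n (fun y => f y ^ a) :=
  hf.rpow_const_of_ne fun y => (h0 y).ne'

theorem laplacian_rpow (hf : ContDiff ℝ 2 f) (h0 : ∀ y, 0 < f y) (a : ℝ)
    (x : EuclideanSpace ℝ (Fin d)) :
    Δ (fun y => f y ^ a) x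
      = a * f x ^ (a - 1) * Δ f x + a * (a - 1) * f x ^ (a - 2) * gradInner f f x := by
  have := laplacian_fun_comp (F := fun t => t ^ a) (F' := fun t => a * t ^ (a - 1))
    (F'' := fun t => a * ((a - 1) * t ^ (a - 1 - 1))) hf (contDiff_rpow hf h0 a)
    (fun y => Real.hasDerivAt_rpow_const (Or.inl (h0 y).ne'))
    (fun y => (Real.hasDerivAt_rpow_const (Or.inl (h0 y).ne')).const_mul a) x
  rw [this, show a - 1 - 1 = a - 2 by ring]
  ring

theorem laplacian_pow (hf : ContDiff ℝ 2 f) (n : ℕ) (x : EuclideanSpace ℝ (Fin d)) :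
    Δ (fun y => f y ^ (n + 2)) x
      = (n + 2) * f x ^ (n + 1) * Δ f x + (n + 2) * (n + 1) * f x ^ n * gradInner f f x := by
  have := laplacian_fun_comp (F := fun t => t ^ (n + 2)) (F' := fun t => (n + 2) * t ^ (n + 1))
    (F'' := fun t => (n + 2) * ((n + 1) * t ^ n)) hf (hf.pow _)
    (fun y => by simpa using hasDerivAt_pow (n + 2) (f y))
    (fun y => by simpa using (hasDerivAt_pow (n + 1) (f y)).const_mul ((n : ℝ) + 2)) x
  rw [this]
  ring

theorem partialDeriv_comp_affine (hf : Differentiable ℝ f) (a : EuclideanSpace ℝ (Fin d)) (R : ℝ)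
    (x : EuclideanSpace ℝ (Fin d)) :
    partialDeriv i (fun y => f (a + R • y)) x = R * partialDeriv i f (a + R • x) := by
  have h : HasFDerivAt (fun y : EuclideanSpace ℝ (Fin d) => a + R • y)
      (R • ContinuousLinearMap.id ℝ (EuclideanSpace ℝ (Fin d))) x :=
    ((hasFDerivAt_id x).const_smul R).const_add a
  have := ((hf (a + R • x)).hasFDerivAt.comp x h).fderiv
  simp only [Function.comp_def] at this
  simp [partialDeriv, this]

theorem contDiff_comp_affine {n : WithTop ℕ∞} (hf : ContDiff ℝ n f)
    (a : EuclideanSpace ℝ (Fin d)) (R : ℝ) : ContDiff ℝ n (fun y => f (a + R • y)) :=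
  hf.comp (contDiff_const.add (contDiff_id.const_smul R))

theorem laplacian_comp_affine (hf : ContDiff ℝ 2 f) (a : EuclideanSpace ℝ (Fin d)) (R : ℝ)
    (x : EuclideanSpace ℝ (Fin d)) :
    Δ (fun y => f (a + R • y)) x = R ^ 2 * Δ f (a + R • x) := by
  rw [laplacian_eq_sum_partialDeriv (contDiff_comp_affine hf a R),
    laplacian_eq_sum_partialDeriv hf, Finset.mul_sum]
  refine Finset.sum_congr rfl fun i _ => ?_
  have dpf := (contDiff_partialDeriv hf i).differentiable (by norm_num)
  have h1 : partialDeriv i (fun y => f (a + R • y)) = fun y => R * partialDeriv i f (a + R • y) :=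
    funext fun y => partialDeriv_comp_affine (hf.differentiable (by norm_num)) a R y
  rw [h1, partialDeriv_const_mul R ((contDiff_comp_affine (contDiff_partialDeriv hf i) a R).differentiable
      (by norm_num) x), partialDeriv_comp_affine dpf]
  ring

theorem laplacian_const_mul (c : ℝ) (hf : ContDiff ℝ 2 f) (x : EuclideanSpace ℝ (Fin d)) :
    Δ (fun y => c * f y) x = c * Δ f x :=
  InnerProductSpace.laplacian_smul c hf.contDiffAt

theorem laplacian_fun_sub (hf : ContDiff ℝ 2 f) (hg : ContDiff ℝ 2 g)
    (x : EuclideanSpace ℝ (Fin d)) :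
    Δ (fun y => f y - g y) x = Δ f x - Δ g x :=
  hf.contDiffAt.laplacian_sub hg.contDiffAt

theorem partialDeriv_eq_zero_of_isLocalMax (h : IsLocalMax f x) : partialDeriv i f x = 0 := by
  simp [partialDeriv, h.fderiv_eq_zero]

/-- On the line through `x` in direction `i`, a positive second derivative would also make the point
a local minimum. The restriction would then be locally constant, with second derivative zero. -/
theorem partialDeriv_partialDeriv_nonpos_of_isLocalMax (hf : ContDiff ℝ 2 f)
    (h : IsLocalMax f x) : partialDeriv i (partialDeriv i f) x ≤ 0 := by
  set e : EuclideanSpace ℝ (Fin d) := EuclideanSpace.single i 1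
  have hline : ∀ t : ℝ, HasDerivAt (fun t : ℝ => x + t • e) e t := fun t => by
    simpa using ((hasDerivAt_id t).smul_const e).const_add x
  have hd1 : deriv (fun t : ℝ => f (x + t • e)) = fun t => partialDeriv i f (x + t • e) :=
    funext fun t => (((hf.differentiable (by norm_num) _).hasFDerivAt).comp_hasDerivAt t
      (hline t)).deriv
  have hd2 : deriv (deriv (fun t : ℝ => f (x + t • e))) 0 = partialDeriv i (partialDeriv i f) x := by
    rw [hd1]
    have := ((((contDiff_partialDeriv hf i).differentiable (by norm_num)
      (x + (0 : ℝ) • e)).hasFDerivAt).comp_hasDerivAt 0 (hline 0)).deriv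
    simpa [partialDeriv, Function.comp_def] using this
  have hcont : ContinuousAt (fun t : ℝ => x + t • e) 0 := (hline 0).continuousAt
  have hmax : IsLocalMax (fun t : ℝ => f (x + t • e)) 0 := by
    have : Tendsto (fun t : ℝ => x + t • e) (𝓝 0) (𝓝 x) := by simpa using hcont.tendsto
    have h2 := this.eventually h
    simpa [IsLocalMax, IsMaxFilter] using h2
  by_contra! hpos
  have hmin := isLocalMin_of_deriv_deriv_pos (hd2 ▸ hpos) hmax.deriv_eq_zero
    (hf.continuous.continuousAt.comp hcont)
  have hconst : (fun t : ℝ => f (x + t • e)) =ᶠ[𝓝 0] fun _ => f (x + (0 : ℝ) • e) := by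
    filter_upwards [hmax, hmin] with t h1 h2 using le_antisymm h1 h2
  have := hconst.deriv.deriv_eq
  rw [hd2] at this
  simp at this
  exact hpos.ne' this

theorem laplacian_nonpos_of_isLocalMax (hf : ContDiff ℝ 2 f) (h : IsLocalMax f x) :
    Δ f x ≤ 0 := by
  rw [laplacian_eq_sum_partialDeriv hf]
  exact Finset.sum_nonpos fun i _ => partialDeriv_partialDeriv_nonpos_of_isLocalMax hf h

theorem hasCompactSupport_partialDeriv (h : HasCompactSupport f) (i : Fin d) :
    HasCompactSupport (partialDeriv i f) :=
  h.fderiv_apply ℝ _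

theorem hasCompactSupport_laplacian (hf : ContDiff ℝ 2 f) (h : HasCompactSupport f) :
    HasCompactSupport (Δ f) := by
  rw [funext (laplacian_eq_sum_partialDeriv hf)]
  refine h.mono' fun x hx => ?_
  by_contra hx'
  refine hx (Finset.sum_eq_zero fun i _ => ?_)
  refine image_eq_zero_of_notMem_tsupport fun h2 => hx' ?_
  exact (tsupport_fderiv_apply_subset ℝ _).trans (tsupport_fderiv_apply_subset ℝ _) h2

/-- Green's first identity. -/
theorem integral_mul_laplacian (hf : ContDiff ℝ 2 f) (hg : ContDiff ℝ 1 g)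
    (h : HasCompactSupport f ∨ HasCompactSupport g) :
    ∫ x, g x * Δ f x = -∫ x, gradInner g f x := by
  have key : ∀ {a b : EuclideanSpace ℝ (Fin d) → ℝ}, Continuous a → Continuous b →
      HasCompactSupport a ∨ HasCompactSupport b → Integrable fun x => a x * b x := by
    intro a b ha hb hab
    exact (ha.mul hb).integrable_of_hasCompactSupport
      (hab.elim (fun h => h.mul_right) (fun h => h.mul_left))
  have hpf : ∀ i, ContDiff ℝ 1 (partialDeriv i f) := contDiff_partialDeriv hf
  have hsw : ∀ i, HasCompactSupport g ∨ HasCompactSupport (partialDeriv i f) := fun i =>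
    h.symm.imp id fun h => hasCompactSupport_partialDeriv h i
  have hi1 : ∀ i, Integrable fun x => g x * partialDeriv i (partialDeriv i f) x := fun i =>
    key hg.continuous (continuous_partialDeriv (hpf i) i)
      (h.symm.imp id fun h => hasCompactSupport_partialDeriv (hasCompactSupport_partialDeriv h i) i)
  have hi2 : ∀ i, Integrable fun x => partialDeriv i g x * partialDeriv i f x := fun i =>
    key (continuous_partialDeriv hg i) (hpf i).continuous
      ((hsw i).imp (fun h => hasCompactSupport_partialDeriv h i) id)
  simp only [laplacian_eq_sum_partialDeriv hf, gradInner, Finset.mul_sum]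
  rw [integral_finsetSum _ fun i _ => hi1 i, integral_finsetSum _ fun i _ => hi2 i,
    ← Finset.sum_neg_distrib]
  refine Finset.sum_congr rfl fun i _ => ?_
  exact integral_mul_fderiv_eq_neg_fderiv_mul_of_integrable (hi2 i) (hi1 i)
    (key hg.continuous (hpf i).continuous (hsw i))
    (fun x _ => hg.differentiable (by norm_num) x)
    (fun x _ => (hpf i).differentiable (by norm_num) x)

end Calculus

/-! ### Positive stable solutions and their scaling. -/

/-- A positive classical solution `(u, v)` of the Lane–Emden system together with a pair `(φ, ψ)`
that witnesses its stability. -/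
structure IsPositiveStable {d : ℕ} (p q : ℝ) (u v φ ψ : EuclideanSpace ℝ (Fin d) → ℝ) : Prop where
  contDiff_u : ContDiff ℝ 2 u
  contDiff_v : ContDiff ℝ 2 v
  contDiff_φ : ContDiff ℝ 2 φ
  contDiff_ψ : ContDiff ℝ 2 ψ
  u_pos : ∀ x, 0 < u x
  v_pos : ∀ x, 0 < v x
  φ_pos : ∀ x, 0 < φ x
  ψ_pos : ∀ x, 0 < ψ x
  laplacian_u : ∀ x, Δ u x = -v x ^ p
  laplacian_v : ∀ x, Δ v x = -u x ^ q
  laplacian_φ : ∀ x, p * v x ^ (p - 1) * ψ x ≤ -Δ φ x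
  laplacian_ψ : ∀ x, q * u x ^ (q - 1) * φ x ≤ -Δ ψ x

theorem IsClassicalSolution.exists_isPositiveStable {d : ℕ} {p q : ℝ}
    {u v : EuclideanSpace ℝ (Fin d) → ℝ} (h : IsClassicalSolution p q u v) (hu : ∀ x, 0 < u x)
    (hv : ∀ x, 0 < v x) (hs : IsStableOn p q u v univ) :
    ∃ φ ψ, IsPositiveStable p q u v φ ψ := by
  obtain ⟨φ, ψ, hφ, hψ, hφ0, hψ0, h1, h2⟩ := hs
  have key : ∀ {t : ℝ} (a : ℝ), 0 < t → |t| ^ (a - 1) * t = t ^ a := fun {t} a ht => by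
    rw [abs_of_pos ht, Real.rpow_sub_one ht.ne', div_mul_cancel₀ _ ht.ne']
  refine ⟨φ, ψ, h.contDiff_fst, h.contDiff_snd, contDiffOn_univ.1 hφ, contDiffOn_univ.1 hψ, hu, hv,
    fun x => hφ0 x trivial, fun x => hψ0 x trivial, fun x => ?_, fun x => ?_, fun x => ?_,
    fun x => ?_⟩
  · rw [← key p (hv x), ← h.eq_fst x, neg_neg]
  · rw [← key q (hu x), ← h.eq_snd x, neg_neg]
  · simpa [abs_of_pos (hv x)] using h1 x trivial
  · simpa [abs_of_pos (hu x)] using h2 x trivial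

/-- The scaling works because `α + 2 = βp` and `β + 2 = αq`. Since `v^(p-1)` gains `R^(β(p-1))` and
`Δφ` gains only `R²`, `ψ` has to be scaled relative to `φ` by the quotient; the second inequality is
then consistent. -/
theorem IsPositiveStable.rescale {d : ℕ} {p q : ℝ} {u v φ ψ : EuclideanSpace ℝ (Fin d) → ℝ}
    (h : IsPositiveStable p q u v φ ψ) (hpq : 1 < p * q) (a : EuclideanSpace ℝ (Fin d)) {R : ℝ}
    (hR : 0 < R) :
    IsPositiveStable p q (fun y => R ^ scalingAlpha p q * u (a + R • y))
      (fun y => R ^ scalingBeta p q * v (a + R • y)) (fun y => φ (a + R • y))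
      (fun y => R ^ (2 - scalingBeta p q * (p - 1)) * ψ (a + R • y)) := by
  have hne : p * q - 1 ≠ 0 := by linarith
  have e1 : scalingAlpha p q + 2 = scalingBeta p q * p := by
    unfold scalingAlpha scalingBeta
    rw [div_add' _ _ _ hne, div_mul_eq_mul_div]; congr 1; ring
  have e2 : scalingBeta p q + 2 = scalingAlpha p q * q := by
    unfold scalingAlpha scalingBeta
    rw [div_add' _ _ _ hne, div_mul_eq_mul_div]; congr 1; ring
  have e3 : 2 - scalingBeta p q * (p - 1) + 2 = scalingAlpha p q * (q - 1) := by
    linear_combination e1 + e2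
  generalize scalingAlpha p q = α at *
  generalize scalingBeta p q = β at *
  have hR2 : R ^ 2 = R ^ (2 : ℝ) := by norm_cast
  have hu := contDiff_comp_affine h.contDiff_u a R
  have hv := contDiff_comp_affine h.contDiff_v a R
  have hφ := contDiff_comp_affine h.contDiff_φ a R
  have hψ := contDiff_comp_affine h.contDiff_ψ a R
  have hα : 0 < R ^ α := Real.rpow_pos_of_pos hR _
  have hβ : 0 < R ^ β := Real.rpow_pos_of_pos hR _
  have hγ : 0 < R ^ (2 - β * (p - 1)) := Real.rpow_pos_of_pos hR _
  refine ⟨contDiff_const.mul hu, contDiff_const.mul hv, hφ, contDiff_const.mul hψ,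
    fun x => mul_pos hα (h.u_pos _), fun x => mul_pos hβ (h.v_pos _), fun x => h.φ_pos _,
    fun x => mul_pos hγ (h.ψ_pos _), fun x => ?_, fun x => ?_, fun x => ?_, fun x => ?_⟩
  · rw [laplacian_const_mul _ hu, laplacian_comp_affine h.contDiff_u, h.laplacian_u,
      Real.mul_rpow hβ.le (h.v_pos _).le, ← Real.rpow_mul hR.le, ← e1, Real.rpow_add hR, hR2]
    ring
  · rw [laplacian_const_mul _ hv, laplacian_comp_affine h.contDiff_v, h.laplacian_v,
      Real.mul_rpow hα.le (h.u_pos _).le, ← Real.rpow_mul hR.le, ← e2, Real.rpow_add hR, hR2]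
    ring
  · rw [laplacian_comp_affine h.contDiff_φ, Real.mul_rpow hβ.le (h.v_pos _).le,
      ← Real.rpow_mul hR.le]
    have e : R ^ (β * (p - 1)) * R ^ (2 - β * (p - 1)) = R ^ 2 := by
      rw [← Real.rpow_add hR, hR2]; congr 1; ring
    calc _ = (R ^ (β * (p - 1)) * R ^ (2 - β * (p - 1))) *
          (p * v (a + R • x) ^ (p - 1) * ψ (a + R • x)) := by ring
      _ ≤ R ^ 2 * -Δ φ (a + R • x) := by
          rw [e]; exact mul_le_mul_of_nonneg_left (h.laplacian_φ _) (by positivity)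
      _ = _ := by ring
  · rw [laplacian_const_mul _ hψ, laplacian_comp_affine h.contDiff_ψ,
      Real.mul_rpow hα.le (h.u_pos _).le, ← Real.rpow_mul hR.le, ← e3, Real.rpow_add hR, ← hR2]
    calc _ = (R ^ (2 - β * (p - 1)) * R ^ 2) *
          (q * u (a + R • x) ^ (q - 1) * φ (a + R • x)) := by ring
      _ ≤ (R ^ (2 - β * (p - 1)) * R ^ 2) * -Δ ψ (a + R • x) :=
          mul_le_mul_of_nonneg_left (h.laplacian_ψ _) (by positivity)
      _ = _ := by ring

/-! ### Cutoff functions and the derivatives of their powers. -/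

/-- A compactly supported `C²` function with values in `[0, 1]` that is `1` on the unit ball. -/
structure IsCutoff {d : ℕ} (η : EuclideanSpace ℝ (Fin d) → ℝ) : Prop where
  contDiff : ContDiff ℝ 2 η
  hasCompactSupport : HasCompactSupport η
  nonneg : ∀ x, 0 ≤ η x
  le_one : ∀ x, η x ≤ 1
  eq_one : ∀ x ∈ Metric.closedBall (0 : EuclideanSpace ℝ (Fin d)) 1, η x = 1

theorem exists_isCutoff (d : ℕ) : ∃ η : EuclideanSpace ℝ (Fin d) → ℝ, IsCutoff η := by
  let b : ContDiffBump (0 : EuclideanSpace ℝ (Fin d)) := ⟨1, 2, by norm_num, by norm_num⟩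
  exact ⟨b, b.contDiff, b.hasCompactSupport, fun x => b.nonneg, fun x => b.le_one,
    fun x hx => b.one_of_mem_closedBall hx⟩

namespace IsCutoff

variable {d : ℕ} {η : EuclideanSpace ℝ (Fin d) → ℝ}

theorem hasCompactSupport_pow (h : IsCutoff η) {n : ℕ} (hn : n ≠ 0) :
    HasCompactSupport fun x => η x ^ n :=
  h.hasCompactSupport.comp_left (g := fun t : ℝ => t ^ n) (zero_pow hn)

theorem exists_abs_partialDeriv_le (h : IsCutoff η) :
    ∃ C, 0 ≤ C ∧ ∀ i x, |partialDeriv i η x| ≤ C := by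
  have h1 : ContDiff ℝ 1 η := h.contDiff.of_le (by norm_num)
  choose C hC using fun i => (hasCompactSupport_partialDeriv h.hasCompactSupport
    i).exists_bound_of_continuous (continuous_partialDeriv h1 i)
  refine ⟨∑ i, |C i|, Finset.sum_nonneg fun _ _ => abs_nonneg _, fun i x => ?_⟩
  exact (hC i x).trans ((le_abs_self _).trans
    (Finset.single_le_sum (f := fun i => |C i|) (fun _ _ => abs_nonneg _) (Finset.mem_univ i)))

theorem exists_abs_partialDeriv_pow_le (h : IsCutoff η) (n : ℕ) :
    ∃ C, 0 ≤ C ∧ ∀ i x, |partialDeriv i (fun y => η y ^ (n + 1)) x| ≤ C * η x ^ n := by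
  obtain ⟨C, hC0, hC⟩ := h.exists_abs_partialDeriv_le
  refine ⟨(n + 1) * C, by positivity, fun i x => ?_⟩
  rw [partialDeriv_pow _ (h.contDiff.differentiable (by norm_num) x)]
  have := pow_nonneg (h.nonneg x) n
  simp only [Nat.add_sub_cancel, Nat.cast_add, Nat.cast_one, abs_mul, abs_of_nonneg this]
  rw [abs_of_nonneg (by positivity : (0 : ℝ) ≤ n + 1)]
  calc _ ≤ ((n : ℝ) + 1) * η x ^ n * C := by gcongr; exact hC i x
    _ = _ := by ring

theorem exists_gradInner_pow_le (h : IsCutoff η) (n : ℕ) :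
    ∃ C, 0 ≤ C ∧ ∀ x, gradInner (fun y => η y ^ (n + 1)) (fun y => η y ^ (n + 1)) x
      ≤ C * η x ^ (2 * n) := by
  obtain ⟨C, hC0, hC⟩ := h.exists_abs_partialDeriv_pow_le n
  refine ⟨d * C ^ 2, by positivity, fun x => ?_⟩
  calc _ ≤ ∑ _i : Fin d, (C * η x ^ n) ^ 2 := Finset.sum_le_sum fun i _ => by
        rw [← sq, ← sq_abs]
        exact pow_le_pow_left₀ (abs_nonneg _) (hC i x) 2
    _ = _ := by simp; ring

/-- Two derivatives cost two powers of `η`, so error terms keep a weight `η ^ n` and can be compared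
with weighted integrals of the solution. -/
theorem exists_abs_laplacian_pow_le (h : IsCutoff η) (n : ℕ) :
    ∃ C, 0 ≤ C ∧ ∀ x, |Δ (fun y => η y ^ (n + 2)) x| ≤ C * η x ^ n := by
  obtain ⟨C, hC0, hC⟩ := h.exists_gradInner_pow_le 0
  have hcs := hasCompactSupport_laplacian h.contDiff h.hasCompactSupport
  obtain ⟨D, hD⟩ := hcs.exists_bound_of_continuous (continuous_laplacian h.contDiff)
  have hD0 : 0 ≤ D := (norm_nonneg _).trans (hD 0)
  refine ⟨(n + 2) * D + (n + 2) * (n + 1) * C, by positivity, fun x => ?_⟩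
  have h0 := h.nonneg x
  have hg0 : 0 ≤ gradInner η η x := gradInner_self_nonneg
  have hg : gradInner η η x ≤ C := by simpa using hC x
  have hD' : |Δ η x| ≤ D := hD x
  have hpow : η x ^ (n + 1) ≤ η x ^ n := pow_le_pow_of_le_one h0 (h.le_one x) (Nat.le_succ n)
  rw [laplacian_pow h.contDiff]
  refine (abs_add_le _ _).trans ?_
  rw [abs_mul, abs_of_nonneg (by positivity : (0 : ℝ) ≤ (n + 2) * η x ^ (n + 1)),
    abs_of_nonneg (by positivity : (0 : ℝ) ≤ (n + 2) * (n + 1) * η x ^ n * gradInner η η x)]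
  calc _ ≤ ((n : ℝ) + 2) * η x ^ n * D + (n + 2) * (n + 1) * η x ^ n * C := by gcongr
    _ = _ := by ring

end IsCutoff

/-! ### Keller–Osserman estimate and pointwise comparison of `v` with `u`. -/

/-- The Keller–Osserman bound at the origin. -/
theorem exists_keller_osserman_bound {d : ℕ} {r c : ℝ} (hr : 0 < r) (hc : 0 < c) :
    ∃ C : ℝ, ∀ w : EuclideanSpace ℝ (Fin d) → ℝ, ContDiff ℝ 2 w →
      (∀ x, 0 < w x → c * w x ^ (1 + r) ≤ Δ w x) → w 0 ≤ C := by
  obtain ⟨η, hη⟩ := exists_isCutoff d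
  -- This makes `(n + 2) r ≥ 2`, so that `ζ ^ r ≤ η ^ 2` for `ζ = η ^ (n + 2)`.
  obtain ⟨n, hn⟩ := exists_nat_ge (2 / r)
  obtain ⟨C₁, hC₁0, hC₁⟩ := hη.exists_gradInner_pow_le (n + 1)
  obtain ⟨C₂, hC₂0, hC₂⟩ := hη.exists_abs_laplacian_pow_le n
  set D := (2 * C₁ + C₂) / c with hD
  have hD0 : 0 ≤ D := by positivity
  refine ⟨D ^ (1 / r), fun w hw hΔ => ?_⟩
  rcases le_or_gt (w 0) 0 with hw0 | hw0
  · exact hw0.trans (Real.rpow_nonneg hD0 _)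
  set ζ : EuclideanSpace ℝ (Fin d) → ℝ := fun y => η y ^ (n + 2) with hζdef
  have hζ : ContDiff ℝ 2 ζ := hη.contDiff.pow _
  have hζs : HasCompactSupport ζ := hη.hasCompactSupport_pow (by omega)
  have hg : ContDiff ℝ 2 fun y => w y * ζ y := hw.mul hζ
  obtain ⟨x, hx⟩ := hg.continuous.exists_forall_ge_of_hasCompactSupport
    (hζs.mul_left (f := w))
  have hmax : IsLocalMax (fun y => w y * ζ y) x := Eventually.of_forall hx
  have hge : w 0 ≤ w x * ζ x := by
    have := hx 0
    simpa [hζdef, hη.eq_one 0 (by simp)] using this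
  have he0 := hη.nonneg x
  have he : 0 < η x := by
    rcases he0.eq_or_lt with h0 | h0
    · simp [hζdef, ← h0] at hge; linarith
    · exact h0
  have hζx : 0 < ζ x := pow_pos he _
  have hwx : 0 < w x := pos_of_mul_pos_left (hw0.trans_le hge) hζx.le
  have dw := hw.differentiable (by norm_num) x
  have dζ := hζ.differentiable (by norm_num) x
  -- At the maximum of `w ζ` one has `ζ ∇w = -w ∇ζ`, which removes the gradient of `w`.
  have h1 : ζ x * gradInner w ζ x = -(w x * gradInner ζ ζ x) := by
    simp only [gradInner, Finset.mul_sum, ← Finset.sum_neg_distrib]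
    refine Finset.sum_congr rfl fun i _ => ?_
    have := partialDeriv_eq_zero_of_isLocalMax (i := i) hmax
    rw [partialDeriv_mul dw dζ] at this
    linear_combination partialDeriv i ζ x * this
  have h2 := laplacian_nonpos_of_isLocalMax hg hmax
  rw [laplacian_fun_mul hw hζ] at h2
  have h3 : gradInner ζ ζ x ≤ C₁ * η x ^ (2 * (n + 1)) := hC₁ x
  have h4 : -(C₂ * η x ^ n) ≤ Δ ζ x := (abs_le.1 (hC₂ x)).1
  have h5 : ζ x * (ζ x * Δ w x) ≤ w x * ((2 * C₁ + C₂) * η x ^ (2 * (n + 1))) := by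
    have e1 := mul_le_mul_of_nonneg_left h2 hζx.le
    have e2 := mul_le_mul_of_nonneg_left h3 hwx.le
    have e3 := mul_le_mul_of_nonneg_left h4 (mul_pos hwx hζx).le
    have e4 : ζ x * η x ^ n = η x ^ (2 * (n + 1)) := by rw [hζdef]; ring
    have e5 : w x * ζ x * -(C₂ * η x ^ n) = -(w x * (C₂ * η x ^ (2 * (n + 1)))) := by
      rw [← e4]; ring
    nlinarith
  have h6 : η x ^ 2 * Δ w x ≤ w x * (2 * C₁ + C₂) := by
    have e : ζ x * (ζ x * Δ w x) = η x ^ (2 * (n + 1)) * (η x ^ 2 * Δ w x) := by rw [hζdef]; ring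
    rw [e, show w x * ((2 * C₁ + C₂) * η x ^ (2 * (n + 1)))
      = η x ^ (2 * (n + 1)) * (w x * (2 * C₁ + C₂)) by ring] at h5
    exact le_of_mul_le_mul_left h5 (by positivity)
  have h7 : η x ^ 2 * w x ^ r ≤ D := by
    have e := (mul_le_mul_of_nonneg_left (hΔ x hwx) (sq_nonneg (η x))).trans h6
    rw [Real.rpow_add hwx, Real.rpow_one] at e
    rw [hD, le_div_iff₀ hc]
    refine le_of_mul_le_mul_left ?_ hwx
    linarith
  have h8 : (w x * ζ x) ^ r ≤ D := by
    rw [Real.mul_rpow hwx.le hζx.le, mul_comm]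
    refine le_trans ?_ h7
    gcongr
    change (η x ^ (n + 2)) ^ r ≤ η x ^ 2
    rw [← Real.rpow_natCast, ← Real.rpow_mul he0, ← Real.rpow_natCast]
    refine Real.rpow_le_rpow_of_exponent_ge he (hη.le_one x) ?_
    rw [div_le_iff₀ hr] at hn
    push_cast
    nlinarith
  calc w 0 ≤ w x * ζ x := hge
    _ = ((w x * ζ x) ^ r) ^ (1 / r) := by
        rw [← Real.rpow_mul (by positivity), mul_one_div_cancel hr.ne', Real.rpow_one]
    _ ≤ D ^ (1 / r) := by gcongr

/-- The difference `w = v - l u^σ` satisfies `Δw ≥ c w^(1+r)` wherever it is positive, so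
Keller–Osserman bounds `w 0` by a constant common to all solutions. Rescaling about `x` turns this
into `R^β w(x) ≤ C` for all `R > 0`, hence `w ≤ 0`. -/
theorem IsPositiveStable.exists_comparison {p q : ℝ} (hq : 1 < q) (hpq : q ≤ p) :
    ∃ l : ℝ, 0 < l ∧ ∀ {d : ℕ} {u v φ ψ : EuclideanSpace ℝ (Fin d) → ℝ},
      IsPositiveStable p q u v φ ψ → ∀ x, v x ≤ l * u x ^ ((q + 1) / (p + 1)) := by
  have hp : 1 < p := hq.trans_le hpq
  have hpq1 : 1 < p * q := by nlinarith
  set σ := (q + 1) / (p + 1) with hσ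
  have hσ0 : 0 < σ := by positivity
  have hσ1 : σ ≤ 1 := by rw [hσ, div_le_one (by linarith)]; linarith
  have hσp : σ * (p + 1) = q + 1 := by rw [hσ]; field_simp
  set l := (1 / σ) ^ (1 / (p + 1)) with hl
  have hl0 : 0 < l := by positivity
  have hlp : l ^ (p + 1) * σ = 1 := by
    rw [hl, ← Real.rpow_mul (by positivity), one_div_mul_cancel (by linarith), Real.rpow_one,
      one_div_mul_cancel hσ0.ne']
  refine ⟨l, hl0, fun {d u v φ ψ} h x => ?_⟩
  set r := p - 1 / σ with hr
  have hr0 : 0 < r := by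
    rw [hr, sub_pos, div_lt_iff₀ hσ0]
    nlinarith
  obtain ⟨C, hC⟩ := exists_keller_osserman_bound (d := d) hr0
    (show 0 < l ^ (1 / σ) * σ by positivity)
  have key : ∀ {u v φ ψ : EuclideanSpace ℝ (Fin d) → ℝ}, IsPositiveStable p q u v φ ψ →
      v 0 - l * u 0 ^ σ ≤ C := by
    intro u v φ ψ h
    have hu := h.contDiff_u
    have huσ := contDiff_rpow hu h.u_pos σ
    refine hC (fun y => v y - l * u y ^ σ) (h.contDiff_v.sub (contDiff_const.mul huσ))
      fun y hy => ?_
    rw [laplacian_fun_sub h.contDiff_v (contDiff_const.mul huσ), laplacian_const_mul _ huσ,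
      laplacian_rpow hu h.u_pos, h.laplacian_u, h.laplacian_v]
    have hu0 := h.u_pos y
    have hv0 := h.v_pos y
    generalize u y = a at *
    generalize v y = b at *
    have hΓ : 0 ≤ gradInner u u y := gradInner_self_nonneg
    set z := l * a ^ σ with hz
    have hz0 : 0 < z := by positivity
    have hzb : z < b := by linarith
    -- The normalization `l^(p+1) σ = 1` is chosen for this identity: it turns `Δw` into a multiple
    -- of `b^p - z^p` plus a gradient term, nonnegative because `σ ≤ 1`.
    have e1 : l * σ * a ^ (σ - 1) * z ^ p = a ^ q := by
      rw [hz, Real.mul_rpow hl0.le (by positivity), ← Real.rpow_mul hu0.le]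
      have : a ^ (σ - 1) * a ^ (σ * p) = a ^ q := by
        rw [← Real.rpow_add hu0]; congr 1; linarith
      have h2 : l ^ (p + 1) = l ^ p * l := by rw [Real.rpow_add_one hl0.ne']
      calc _ = (l ^ p * l * σ) * (a ^ (σ - 1) * a ^ (σ * p)) := by ring
        _ = _ := by rw [← h2, hlp, this, one_mul]
    have e2 : b ^ (p - 1) * (b - z) ≤ b ^ p - z ^ p := by
      have h1 : b ^ p = b ^ (p - 1) * b := by
        rw [Real.rpow_sub_one hv0.ne']; field_simp
      have h2 : z ^ p = z ^ (p - 1) * z := by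
        rw [Real.rpow_sub_one hz0.ne']; field_simp
      have h3 : z ^ (p - 1) ≤ b ^ (p - 1) := Real.rpow_le_rpow hz0.le hzb.le (by linarith)
      rw [h1, h2]
      nlinarith
    -- As `σ ≤ 1`, the exponent `1 - 1/σ` is nonpositive, and `z` may be replaced by the larger `b`.
    have e3 : (b / l) ^ (1 - 1 / σ) ≤ a ^ (σ - 1) := by
      have h1 : a ^ (σ - 1) = (z / l) ^ (1 - 1 / σ) := by
        rw [hz, mul_div_cancel_left₀ _ hl0.ne', ← Real.rpow_mul hu0.le]
        congr 1; field_simp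
      rw [h1]
      refine Real.rpow_le_rpow_of_nonpos (by positivity) (by gcongr) ?_
      rw [sub_nonpos, le_div_iff₀ hσ0]; linarith
    have e4 : l * (b / l) ^ (1 - 1 / σ) * b ^ (p - 1) = l ^ (1 / σ) * b ^ r := by
      rw [Real.div_rpow hv0.le hl0.le, hr, show p - 1 / σ = (1 - 1 / σ) + (p - 1) by ring,
        Real.rpow_add hv0, Real.rpow_sub hl0, Real.rpow_one]
      field_simp
    have e5 : (b - z) ^ r ≤ b ^ r := Real.rpow_le_rpow (by linarith) (by linarith) hr0.le
    have e6 : 0 ≤ l * σ * (1 - σ) * a ^ (σ - 2) * gradInner u u y := by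
      have : 0 ≤ 1 - σ := by linarith
      positivity
    have hpos : 0 < b - z := by linarith
    calc l ^ (1 / σ) * σ * (b - z) ^ (1 + r)
        = l ^ (1 / σ) * σ * ((b - z) * (b - z) ^ r) := by
          rw [Real.rpow_add hpos, Real.rpow_one]
      _ ≤ l ^ (1 / σ) * σ * ((b - z) * b ^ r) := by gcongr
      _ = (l * (b / l) ^ (1 - 1 / σ) * b ^ (p - 1)) * σ * (b - z) := by rw [e4]; ring
      _ ≤ (l * a ^ (σ - 1) * b ^ (p - 1)) * σ * (b - z) := by gcongr
      _ = l * σ * a ^ (σ - 1) * (b ^ (p - 1) * (b - z)) := by ring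
      _ ≤ l * σ * a ^ (σ - 1) * (b ^ p - z ^ p) := by gcongr
      _ = l * σ * a ^ (σ - 1) * b ^ p - a ^ q := by rw [mul_sub, e1]
      _ ≤ _ := by linarith
  have hβ : 0 < scalingBeta p q := by
    unfold scalingBeta
    have : 0 < p * q - 1 := by linarith
    positivity
  have hαβ : scalingAlpha p q * σ = scalingBeta p q := by
    unfold scalingAlpha scalingBeta
    have : p * q - 1 ≠ 0 := by linarith
    rw [hσ]; field_simp
  have hbound : ∀ R : ℝ, 0 < R → R ^ scalingBeta p q * (v x - l * u x ^ σ) ≤ C := by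
    intro R hR
    have := key (h.rescale hpq1 x hR)
    simp only [smul_zero, add_zero] at this
    rw [Real.mul_rpow (by positivity) (h.u_pos x).le, ← Real.rpow_mul hR.le, hαβ] at this
    linarith
  by_contra! hlt
  have ht := (tendsto_rpow_atTop hβ).atTop_mul_const (sub_pos.2 hlt)
  obtain ⟨R, hR, hR0⟩ := ((ht.eventually_gt_atTop C).and (eventually_gt_atTop 0)).exists
  exact absurd (hbound R hR0) (not_le.2 hR)

/-! ### The quartic below its largest root. -/

theorem quarticH_eq (p q x : ℝ) : quarticH p q x = x ^ 4 - p * q * scalingAlpha p q *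
    scalingBeta p q * ((2 * x - scalingAlpha p q) * (2 * x - scalingBeta p q)) := by
  unfold quarticH; ring

theorem log_convexCombo_le {a b x y : ℝ} (ha : 0 ≤ a) (hb : 0 ≤ b) (hab : a + b = 1) (hx : 0 < x)
    (hy : 0 < y) : a * Real.log x + b * Real.log y ≤ Real.log (a * x + b * y) := by
  simpa using strictConcaveOn_log_Ioi.concaveOn.2 hx hy ha hb hab

/-- Between a point where `c (2x - A) (2x - B) > x⁴` and one where `c (2x - A) (2x - B) = x⁴`,
the strict inequality persists. -/
theorem pow_four_lt_of_mem_Ico {A B c x₁ x₀ x : ℝ} (hc : 0 < c) (h0 : 0 < x₁) (hA : A < 2 * x₁)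
    (hB : B < 2 * x₁)
    (h₁ : x₁ ^ 4 < c * ((2 * x₁ - A) * (2 * x₁ - B)))
    (h₀ : x₀ ^ 4 = c * ((2 * x₀ - A) * (2 * x₀ - B))) (hx : x₁ ≤ x) (hx' : x < x₀) :
    x ^ 4 < c * ((2 * x - A) * (2 * x - B)) := by
  have hx0 : 0 < x := h0.trans_le hx
  have hx00 : 0 < x₀ := hx0.trans hx'
  -- In the variable `y = 1/x` the logarithm of `c (2x - A)(2x - B) / x⁴` is concave, being a sum of
  -- logarithms of affine functions. It is positive at `1/x₁` and zero at `1/x₀`, hence positive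
  -- between.
  set F : ℝ → ℝ := fun y => Real.log c + Real.log (2 - A * y) + Real.log (2 - B * y)
    + 2 * Real.log y with hF
  have key : ∀ t, x₁ ≤ t → Real.log (c * ((2 * t - A) * (2 * t - B))) =
      F (1 / t) + Real.log (t ^ 4) := by
    intro t ht
    have t0 : 0 < t := h0.trans_le ht
    have e1 : 2 * t - A = t * (2 - A * (1 / t)) := by field_simp
    have e2 : 2 * t - B = t * (2 - B * (1 / t)) := by field_simp
    have p1 : 0 < 2 - A * (1 / t) := pos_of_mul_pos_right (e1 ▸ by linarith) t0.le
    have p2 : 0 < 2 - B * (1 / t) := pos_of_mul_pos_right (e2 ▸ by linarith) t0.le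
    rw [e1, e2, Real.log_mul hc.ne' (by positivity), Real.log_mul (by positivity) (by positivity),
      Real.log_mul t0.ne' p1.ne', Real.log_mul t0.ne' p2.ne', Real.log_pow, hF]
    simp only [one_div, Real.log_inv]
    push_cast
    ring
  have hpos : ∀ t, x₁ ≤ t → 0 < c * ((2 * t - A) * (2 * t - B)) := fun t ht =>
    mul_pos hc (mul_pos (by linarith) (by linarith))
  have f1 : 0 < F (1 / x₁) := by
    have := Real.log_lt_log (by positivity) h₁
    rw [key x₁ le_rfl] at this
    linarith
  have f0 : F (1 / x₀) = 0 := by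
    have := key x₀ (hx.trans hx'.le)
    rw [← h₀] at this
    linarith
  set b := (1 / x₁ - 1 / x) / (1 / x₁ - 1 / x₀) with hb
  have hd1 : 0 ≤ 1 / x₁ - 1 / x := sub_nonneg.2 (one_div_le_one_div_of_le h0 hx)
  have hd2 : 0 < 1 / x - 1 / x₀ := sub_pos.2 (one_div_lt_one_div_of_lt hx0 hx')
  have hd3 : 0 < 1 / x₁ - 1 / x₀ := by linarith
  have hb0 : 0 ≤ b := by positivity
  have hb1 : 0 < 1 - b := by
    rw [hb, sub_pos, div_lt_one hd3]; linarith
  have hcomb : (1 - b) * (1 / x₁) + b * (1 / x₀) = 1 / x := by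
    have : b * (1 / x₁ - 1 / x₀) = 1 / x₁ - 1 / x := div_mul_cancel₀ _ hd3.ne'
    linarith
  have hp : ∀ t D, x₁ ≤ t → D < 2 * x₁ → 0 < 2 - D * (1 / t) := by
    intro t D ht hD
    have t0 : 0 < t := h0.trans_le ht
    rw [sub_pos, mul_one_div, div_lt_iff₀ t0]; linarith
  have c1 := log_convexCombo_le hb1.le hb0 (by ring) (hp x₁ A le_rfl hA)
    (hp x₀ A (hx.trans hx'.le) hA)
  have c2 := log_convexCombo_le hb1.le hb0 (by ring) (hp x₁ B le_rfl hB)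
    (hp x₀ B (hx.trans hx'.le) hB)
  have c3 := log_convexCombo_le hb1.le hb0 (by ring) (one_div_pos.2 h0) (one_div_pos.2 hx00)
  rw [show (1 - b) * (2 - A * (1 / x₁)) + b * (2 - A * (1 / x₀)) = 2 - A * (1 / x) by
    rw [← hcomb]; ring] at c1
  rw [show (1 - b) * (2 - B * (1 / x₁)) + b * (2 - B * (1 / x₀)) = 2 - B * (1 / x) by
    rw [← hcomb]; ring] at c2
  rw [hcomb] at c3
  have f2 : (1 - b) * F (1 / x₁) + b * F (1 / x₀) ≤ F (1 / x) := by
    simp only [hF]; linarith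
  rw [f0] at f2
  have f3 : 0 < F (1 / x) := by nlinarith
  refine (Real.log_lt_log_iff (by positivity) (hpos x hx)).1 ?_
  rw [key x hx]
  linarith

/-- The last clause supplies the test exponent: `α(q+1)/2 ≤ x` means `s = 2x/α - 1 ≥ q`, and `H(x) <
0` is the absorption condition. -/
theorem exists_isGreatest_quarticH {p q : ℝ} (hq : 1 < q) (hp : 1 < p) :
    ∃ x₀ : ℝ, IsGreatest {x : ℝ | quarticH p q x = 0} x₀ ∧
      ∀ y < x₀, ∃ x, y < x ∧ scalingAlpha p q * (q + 1) / 2 ≤ x ∧ quarticH p q x < 0 := by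
  have hpq1 : 0 < p * q - 1 := by nlinarith
  have hα : 0 < scalingAlpha p q := by unfold scalingAlpha; positivity
  have hβ : 0 < scalingBeta p q := by unfold scalingBeta; positivity
  have hαβ : scalingAlpha p q * (q + 1) = scalingBeta p q * (p + 1) := by
    unfold scalingAlpha scalingBeta; ring
  have hH := quarticH_eq p q
  generalize quarticH p q = H at *
  generalize scalingAlpha p q = α at *
  generalize scalingBeta p q = β at *
  set c := p * q * α * β with hc
  have hc0 : 0 < c := by positivity
  -- This point corresponds to `s = q`, `t = p`; there `H < 0` reduces to `(q + 1)(p + 1) < 4pq`.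
  set x₁ := α * (q + 1) / 2 with hx₁
  have hx₁0 : 0 < x₁ := by positivity
  have e1 : 2 * x₁ - α = α * q := by rw [hx₁]; ring
  have e2 : 2 * x₁ - β = β * p := by rw [hx₁, hαβ]; ring
  have h1 : x₁ ^ 4 < c * ((2 * x₁ - α) * (2 * x₁ - β)) := by
    rw [e1, e2]
    have e3 : x₁ ^ 2 = α * β * ((q + 1) * (p + 1)) / 4 := by
      rw [show x₁ ^ 2 = (α * (q + 1)) * (α * (q + 1)) / 4 by rw [hx₁]; ring]
      nth_rw 2 [hαβ]; ring
    have e4 : x₁ ^ 2 < p * q * (α * β) := by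
      rw [e3]
      have h2 : (q + 1) * (p + 1) < 4 * (p * q) := by nlinarith
      nlinarith [mul_pos hα hβ]
    calc x₁ ^ 4 = (x₁ ^ 2) ^ 2 := by ring
      _ < (p * q * (α * β)) ^ 2 := pow_lt_pow_left₀ e4 (by positivity) (by norm_num)
      _ = _ := by rw [hc]; ring
  have hH1 : H x₁ < 0 := by rw [hH]; linarith
  set M := x₁ + α + β + 4 * c + 1 with hM
  have hbig : ∀ x, M ≤ x → 0 < H x := by
    intro x hx
    have hx0 : 1 ≤ x := by linarith
    rw [hH]
    have a1 : (2 * x - α) * (2 * x - β) ≤ (2 * x) * (2 * x) :=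
      mul_le_mul (by linarith) (by linarith) (by linarith) (by linarith)
    have a2 : 4 * c < x ^ 2 := by nlinarith
    have a3 : c * ((2 * x - α) * (2 * x - β)) ≤ c * ((2 * x) * (2 * x)) := by gcongr
    have a4 : 4 * c * x ^ 2 < x ^ 2 * x ^ 2 := by gcongr
    nlinarith
  have hcont : Continuous H := by rw [funext hH]; fun_prop
  have hclosed : IsClosed {x | H x = 0} := isClosed_eq hcont continuous_const
  have hbdd : BddAbove {x | H x = 0} := ⟨M, fun x hx => by
    by_contra! h
    exact (hbig x h.le).ne' hx⟩
  obtain ⟨z, hz, hz0⟩ := intermediate_value_Icc (by linarith : x₁ ≤ M) hcont.continuousOn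
    ⟨hH1.le, (hbig M le_rfl).le⟩
  have hgr : IsGreatest {x | H x = 0} (sSup {x | H x = 0}) :=
    ⟨hclosed.csSup_mem ⟨z, hz0⟩ hbdd, fun x hx => le_csSup hbdd hx⟩
  set x₀ := sSup {x | H x = 0}
  have hx₁₀ : x₁ < x₀ := by
    refine lt_of_le_of_ne (hz.1.trans (hgr.2 hz0)) fun h => hH1.ne ?_
    rw [h]; exact hgr.1
  refine ⟨x₀, hgr, fun y hy => ⟨max x₁ ((y + x₀) / 2), ?_, le_max_left _ _, ?_⟩⟩
  · exact lt_max_of_lt_right (by linarith)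
  · have h0 : H x₀ = 0 := hgr.1
    rw [hH] at h0
    rw [hH, sub_neg]
    refine pow_four_lt_of_mem_Ico hc0 hx₁0 ?_ ?_ h1 (sub_eq_zero.1 h0) (le_max_left _ _)
      (max_lt hx₁₀ (by linarith))
    · have : 0 < α * q := by positivity
      linarith
    · have : 0 < β * p := by positivity
      linarith

/-! ### Integral form of stability. -/

section Integrals

variable {d : ℕ} {f g γ φ : EuclideanSpace ℝ (Fin d) → ℝ}

theorem integrable_mul_of_hasCompactSupport (hf : Continuous f) (hg : Continuous g)
    (h : HasCompactSupport g) : Integrable fun x => f x * g x :=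
  (hf.mul hg).integrable_of_hasCompactSupport h.mul_left

/-- Green's second identity. -/
theorem integral_mul_laplacian_comm (hf : ContDiff ℝ 2 f) (hg : ContDiff ℝ 2 g)
    (h : HasCompactSupport g) : ∫ x, g x * Δ f x = ∫ x, f x * Δ g x := by
  rw [integral_mul_laplacian hf (hg.of_le (by norm_num)) (Or.inr h),
    integral_mul_laplacian hg (hf.of_le (by norm_num)) (Or.inl h)]
  simp only [gradInner_comm]

theorem hasCompactSupport_gradInner_left (h : HasCompactSupport f) :
    HasCompactSupport (gradInner f g) := by
  refine h.mono' fun x hx => ?_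
  by_contra hx'
  refine hx (Finset.sum_eq_zero fun i _ => ?_)
  have : partialDeriv i f x = 0 := image_eq_zero_of_notMem_tsupport fun h2 =>
    hx' (tsupport_fderiv_apply_subset ℝ _ h2)
  rw [this, zero_mul]

/-- Picone's identity: `|∇γ|² - ∇(γ²/φ)·∇φ = |∇γ - (γ/φ)∇φ|² ≥ 0`. -/
theorem integral_neg_laplacian_div_mul_sq_le (hφ : ContDiff ℝ 2 φ) (h0 : ∀ x, 0 < φ x)
    (hγ : ContDiff ℝ 1 γ) (hγs : HasCompactSupport γ) :
    ∫ x, -Δ φ x / φ x * γ x ^ 2 ≤ ∫ x, gradInner γ γ x := by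
  set g : EuclideanSpace ℝ (Fin d) → ℝ := fun x => γ x ^ 2 * (φ x)⁻¹ with hg
  have hφ1 : ContDiff ℝ 1 φ := hφ.of_le (by norm_num)
  have hg1 : ContDiff ℝ 1 g := (hγ.pow 2).mul (hφ1.inv fun x => (h0 x).ne')
  have hγ2 : HasCompactSupport fun x => γ x ^ 2 :=
    hγs.comp_left (g := fun t : ℝ => t ^ 2) (by simp)
  have hgs : HasCompactSupport g := hγ2.mul_right
  have h1 : ∫ x, -Δ φ x / φ x * γ x ^ 2 = ∫ x, gradInner g φ x := by
    rw [← neg_eq_iff_eq_neg.2 (integral_mul_laplacian hφ hg1 (Or.inr hgs)), ← integral_neg]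
    congr 1 with x
    simp only [hg]; ring
  rw [h1]
  refine integral_mono ((continuous_gradInner hg1 hφ1).integrable_of_hasCompactSupport
    (hasCompactSupport_gradInner_left hgs)) ((continuous_gradInner hγ
      hγ).integrable_of_hasCompactSupport (hasCompactSupport_gradInner_left hγs)) fun x => ?_
  refine Finset.sum_le_sum fun i _ => ?_
  have dφ := hφ1.differentiable (by norm_num) x
  have dγ := hγ.differentiable (by norm_num) x
  have hne := (h0 x).ne'
  have e1 : partialDeriv i g x = γ x ^ 2 * (-(φ x ^ 2)⁻¹ * partialDeriv i φ x)
      + (φ x)⁻¹ * (2 * γ x * partialDeriv i γ x) := by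
    rw [hg, partialDeriv_mul (dγ.fun_pow 2) (dφ.fun_inv hne), partialDeriv_pow 2 dγ,
      partialDeriv_comp (F := fun t => t⁻¹) (hasDerivAt_inv hne) dφ]
    simp
  rw [e1]
  have e2 : partialDeriv i γ x * partialDeriv i γ x
      - (γ x ^ 2 * (-(φ x ^ 2)⁻¹ * partialDeriv i φ x)
        + (φ x)⁻¹ * (2 * γ x * partialDeriv i γ x)) * partialDeriv i φ x
      = (partialDeriv i γ x - γ x * (φ x)⁻¹ * partialDeriv i φ x) ^ 2 := by
    rw [← inv_pow]; ring
  nlinarith [sq_nonneg (partialDeriv i γ x - γ x * (φ x)⁻¹ * partialDeriv i φ x)]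

end Integrals

theorem IsCutoff.abs_integral_mul_laplacian_le {d n : ℕ} {C : ℝ}
    {η f : EuclideanSpace ℝ (Fin d) → ℝ} (hη : IsCutoff η)
    (hC : ∀ x, |Δ (fun y => η y ^ (n + 2)) x| ≤ C * η x ^ n) (hf : Continuous f)
    (hf0 : ∀ x, 0 ≤ f x) (hn : n ≠ 0) :
    |∫ x, f x * Δ (fun y => η y ^ (n + 2)) x| ≤ C * ∫ x, f x * η x ^ n := by
  have hk : ContDiff ℝ 2 fun y => η y ^ (n + 2) := hη.contDiff.pow _
  rw [← integral_const_mul]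
  refine (abs_integral_le_integral_abs).trans (integral_mono ?_ ?_ fun x => ?_)
  · exact (integrable_mul_of_hasCompactSupport hf (continuous_laplacian hk)
      (hasCompactSupport_laplacian hk (hη.hasCompactSupport_pow (by omega)))).abs
  · exact (integrable_mul_of_hasCompactSupport hf (hη.contDiff.continuous.pow n)
      (hη.hasCompactSupport_pow hn)).const_mul _
  · simp only [abs_mul, abs_of_nonneg (hf0 x)]
    calc _ ≤ f x * (C * η x ^ n) := mul_le_mul_of_nonneg_left (hC x) (hf0 x)
      _ = _ := by ring

/-- Averaging the Picone inequalities for `φ` and `ψ` produces the ratios `ψ/φ` and `φ/ψ`, whose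
product is 1; the arithmetic-geometric mean inequality eliminates them. -/
theorem IsPositiveStable.integral_le {d : ℕ} {p q : ℝ} {u v φ ψ γ : EuclideanSpace ℝ (Fin d) → ℝ}
    (h : IsPositiveStable p q u v φ ψ) (hp : 0 < p) (hq : 0 < q) (hγ : ContDiff ℝ 1 γ)
    (hγs : HasCompactSupport γ) :
    √(p * q) * ∫ x, u x ^ ((q - 1) / 2) * v x ^ ((p - 1) / 2) * γ x ^ 2
      ≤ ∫ x, gradInner γ γ x := by
  have h1 := integral_neg_laplacian_div_mul_sq_le h.contDiff_φ h.φ_pos hγ hγs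
  have h2 := integral_neg_laplacian_div_mul_sq_le h.contDiff_ψ h.ψ_pos hγ hγs
  have hγ2 : HasCompactSupport fun x => γ x ^ 2 :=
    hγs.comp_left (g := fun t : ℝ => t ^ 2) (by simp)
  have hγc : Continuous fun x => γ x ^ 2 := hγ.continuous.pow 2
  have i1 : Integrable fun x => -Δ φ x / φ x * γ x ^ 2 := integrable_mul_of_hasCompactSupport
    ((continuous_laplacian h.contDiff_φ).neg.div h.contDiff_φ.continuous
      fun x => (h.φ_pos x).ne') hγc hγ2
  have i2 : Integrable fun x => -Δ ψ x / ψ x * γ x ^ 2 := integrable_mul_of_hasCompactSupport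
    ((continuous_laplacian h.contDiff_ψ).neg.div h.contDiff_ψ.continuous
      fun x => (h.ψ_pos x).ne') hγc hγ2
  have i3 : Integrable fun x => u x ^ ((q - 1) / 2) * v x ^ ((p - 1) / 2) * γ x ^ 2 :=
    integrable_mul_of_hasCompactSupport ((contDiff_rpow h.contDiff_u h.u_pos _).continuous.mul
      (contDiff_rpow h.contDiff_v h.v_pos _).continuous) hγc hγ2
  have key : √(p * q) * ∫ x, u x ^ ((q - 1) / 2) * v x ^ ((p - 1) / 2) * γ x ^ 2
      ≤ ∫ x, (1 / 2) * (-Δ φ x / φ x * γ x ^ 2 + -Δ ψ x / ψ x * γ x ^ 2) := by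
    rw [← integral_const_mul]
    refine integral_mono (i3.const_mul _) ((i1.add i2).const_mul _) fun x => ?_
    have hφ := h.φ_pos x
    have hψ := h.ψ_pos x
    have hu := h.u_pos x
    have hv := h.v_pos x
    have a1 : p * v x ^ (p - 1) * (ψ x / φ x) ≤ -Δ φ x / φ x := by
      rw [← mul_div_assoc]; gcongr; exact h.laplacian_φ x
    have a2 : q * u x ^ (q - 1) * (φ x / ψ x) ≤ -Δ ψ x / ψ x := by
      rw [← mul_div_assoc]; gcongr; exact h.laplacian_ψ x
    have a3 : √(p * q) * (u x ^ ((q - 1) / 2) * v x ^ ((p - 1) / 2)) ≤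
        (1 / 2) * (p * v x ^ (p - 1) * (ψ x / φ x) + q * u x ^ (q - 1) * (φ x / ψ x)) := by
      have s1 : u x ^ (q - 1) = (u x ^ ((q - 1) / 2)) ^ 2 := by
        rw [← Real.rpow_natCast, ← Real.rpow_mul hu.le]; congr 1; push_cast; ring
      have s2 : v x ^ (p - 1) = (v x ^ ((p - 1) / 2)) ^ 2 := by
        rw [← Real.rpow_natCast, ← Real.rpow_mul hv.le]; congr 1; push_cast; ring
      rw [s1, s2]
      set a := u x ^ ((q - 1) / 2)
      set b := v x ^ ((p - 1) / 2)
      have ha : 0 < a := Real.rpow_pos_of_pos hu _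
      have hb : 0 < b := Real.rpow_pos_of_pos hv _
      have hsq : √(p * q) ^ 2 = p * q := Real.sq_sqrt (by positivity)
      set X := p * b ^ 2 * (ψ x / φ x)
      set Y := q * a ^ 2 * (φ x / ψ x)
      have hX : 0 < X := by positivity
      have hY : 0 < Y := by positivity
      have hXY : (√(p * q) * (a * b)) ^ 2 = X * Y := by
        rw [mul_pow, hsq]; simp only [X, Y]; field_simp
      refine abs_le_of_sq_le_sq' ?_ (by positivity) |>.2
      rw [hXY]
      nlinarith [sq_nonneg (X - Y)]
    calc √(p * q) * (u x ^ ((q - 1) / 2) * v x ^ ((p - 1) / 2) * γ x ^ 2)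
        = √(p * q) * (u x ^ ((q - 1) / 2) * v x ^ ((p - 1) / 2)) * γ x ^ 2 := by ring
      _ ≤ ((1 / 2) * (-Δ φ x / φ x + -Δ ψ x / ψ x)) * γ x ^ 2 :=
          mul_le_mul_of_nonneg_right (by linarith) (sq_nonneg _)
      _ = _ := by ring
  rw [integral_const_mul, integral_add i1 i2] at key
  linarith

/-! ### A local `L¹` bound common to all solutions. -/

theorem exists_le_mul_rpow_add {p ε : ℝ} (hp : 1 < p) (hε : 0 < ε) :
    ∃ K, 0 ≤ K ∧ ∀ x, 0 ≤ x → x ≤ ε * x ^ p + K := by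
  refine ⟨(1 / ε) ^ (1 / (p - 1)), by positivity, fun x hx => ?_⟩
  rcases le_or_gt x ((1 / ε) ^ (1 / (p - 1))) with h | h
  · have := Real.rpow_nonneg hx p
    nlinarith
  · have hp1 : 0 < p - 1 := by linarith
    have hx0 : 0 < x := lt_of_le_of_lt (by positivity) h
    have h1 : 1 / ε ≤ x ^ (p - 1) := by
      calc 1 / ε = ((1 / ε) ^ (1 / (p - 1))) ^ (p - 1) := by
            rw [← Real.rpow_mul (by positivity), one_div_mul_cancel hp1.ne', Real.rpow_one]
        _ ≤ _ := by gcongr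
    have h2 : x ^ p = x ^ (p - 1) * x := by
      rw [Real.rpow_sub_one hx0.ne']; field_simp
    rw [div_le_iff₀ hε] at h1
    have h3 : 0 ≤ (1 / ε) ^ (1 / (p - 1)) := by positivity
    rw [h2]
    nlinarith

/-- Testing the equations with `η ^ (n + 2)` bounds the superlinear integrals of `v ^ p` and `u ^ q`
by linear ones, which Young's inequality absorbs back. -/
theorem exists_integral_bound {d : ℕ} {p q : ℝ} (hp : 1 < p) (hq : 1 < q)
    {η : EuclideanSpace ℝ (Fin d) → ℝ} (hη : IsCutoff η) :
    ∃ n : ℕ, n ≠ 0 ∧ ∃ C : ℝ, ∀ {u v φ ψ : EuclideanSpace ℝ (Fin d) → ℝ},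
      IsPositiveStable p q u v φ ψ → ∫ x, u x * η x ^ n ≤ C := by
  -- It makes `m a + 1 ≥ n + 2` for `a = p, q`. The power `η ^ n` is split as `η ^ m * η`, the
  -- single factor keeping the additive constant of Young's inequality integrable.
  obtain ⟨m, hm⟩ := exists_nat_ge (3 / (min p q - 1))
  have hmin : 0 < min p q - 1 := sub_pos.2 (lt_min hp hq)
  set n := m + 1 with hn
  obtain ⟨C, hC0, hC⟩ := hη.exists_abs_laplacian_pow_le n
  obtain ⟨K, hK0, hKp⟩ : ∃ K, 0 ≤ K ∧ ∀ x, 0 ≤ x → x ≤ 1 / (2 * (C + 1)) * x ^ p + K :=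
    exists_le_mul_rpow_add hp (by positivity)
  obtain ⟨L, hL0, hLq⟩ : ∃ K, 0 ≤ K ∧ ∀ x, 0 ≤ x → x ≤ 1 / (2 * (C + 1)) * x ^ q + K :=
    exists_le_mul_rpow_add hq (by positivity)
  set ε := 1 / (2 * (C + 1)) with hε
  have hε0 : 0 < ε := by positivity
  have hCε : C * ε ≤ 1 / 2 := by
    rw [hε, mul_one_div, div_le_div_iff₀ (by positivity) (by norm_num)]; linarith
  have hηc := hη.contDiff.continuous
  have hηk : ∀ k, k ≠ 0 → HasCompactSupport fun x => η x ^ k := fun k hk =>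
    hη.hasCompactSupport_pow hk
  have hηi : Integrable η := hηc.integrable_of_hasCompactSupport hη.hasCompactSupport
  have step1 : ∀ {f g : EuclideanSpace ℝ (Fin d) → ℝ} {a : ℝ}, ContDiff ℝ 2 f → (∀ x, 0 < f x) →
      (∀ x, Δ f x = -g x ^ a) → ∫ x, g x ^ a * η x ^ (n + 2) ≤ C * ∫ x, f x * η x ^ n := by
    intro f g a hf hf0 hfg
    have e1 : ∫ x, g x ^ a * η x ^ (n + 2) = ∫ x, f x * -Δ (fun y => η y ^ (n + 2)) x := by
      simp only [mul_neg, integral_neg]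
      rw [← integral_mul_laplacian_comm hf (hη.contDiff.pow _) (hηk _ (by omega)), ← integral_neg]
      congr 1 with x
      rw [hfg]; ring
    rw [e1]
    refine (le_abs_self _).trans ?_
    simp only [mul_neg, integral_neg, abs_neg]
    exact hη.abs_integral_mul_laplacian_le hC hf.continuous (fun x => (hf0 x).le) (by omega)
  have step2 : ∀ {f : EuclideanSpace ℝ (Fin d) → ℝ} {a K : ℝ}, Continuous f → (∀ x, 0 < f x) →
      min p q ≤ a → (∀ x, 0 ≤ x → x ≤ ε * x ^ a + K) →
      ∫ x, f x * η x ^ n ≤ ε * (∫ x, f x ^ a * η x ^ (n + 2)) + K * ∫ x, η x := by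
    intro f a K hf hf0 ha hK
    have i1 : Integrable fun x => f x ^ a * η x ^ (n + 2) :=
      integrable_mul_of_hasCompactSupport (hf.rpow_const fun x => Or.inl (hf0 x).ne')
        (hηc.pow _) (hηk _ (by omega))
    rw [← integral_const_mul, ← integral_const_mul, ← integral_add (i1.const_mul _)
      (hηi.const_mul _)]
    refine integral_mono (integrable_mul_of_hasCompactSupport hf (hηc.pow _) (hηk _ (by omega)))
      ((i1.const_mul _).add (hηi.const_mul _)) fun x => ?_
    have h0 := hη.nonneg x
    have h1 := hK (f x * η x ^ m) (mul_nonneg (hf0 x).le (pow_nonneg h0 _))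
    have h2 : (f x * η x ^ m) ^ a * η x ≤ f x ^ a * η x ^ (n + 2) := by
      rw [Real.mul_rpow (hf0 x).le (pow_nonneg h0 _), mul_assoc]
      refine mul_le_mul_of_nonneg_left ?_ (Real.rpow_nonneg (hf0 x).le _)
      rcases h0.eq_or_lt with h | h
      · simp [← h]
      · rw [← Real.rpow_natCast, ← Real.rpow_mul h0, ← Real.rpow_add_one h.ne',
          ← Real.rpow_natCast]
        refine Real.rpow_le_rpow_of_exponent_ge h (hη.le_one x) ?_
        rw [div_le_iff₀ hmin] at hm
        have hm' : (m : ℝ) * (min p q - 1) ≤ m * (a - 1) := by gcongr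
        rw [hn]; push_cast; nlinarith
    calc f x * η x ^ n = (f x * η x ^ m) * η x := by rw [hn]; ring
      _ ≤ (ε * (f x * η x ^ m) ^ a + K) * η x := by gcongr
      _ = ε * ((f x * η x ^ m) ^ a * η x) + K * η x := by ring
      _ ≤ _ := by gcongr
  refine ⟨n, m.succ_ne_zero, ε * (2 * (C * (K * ∫ x, η x) + C * (L * ∫ x, η x))) + L * ∫ x, η x,
    fun {u v φ ψ} h => ?_⟩
  have hu2 := step1 (a := q) h.contDiff_v h.v_pos h.laplacian_v
  have hv2 := step1 (a := p) h.contDiff_u h.u_pos h.laplacian_u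
  have hu3 := step2 (a := q) h.contDiff_u.continuous h.u_pos (min_le_right _ _) hLq
  have hv3 := step2 (a := p) h.contDiff_v.continuous h.v_pos (min_le_left _ _) hKp
  have hU0 : 0 ≤ ∫ x, u x ^ q * η x ^ (n + 2) := integral_nonneg fun x =>
    mul_nonneg (Real.rpow_nonneg (h.u_pos x).le _) (pow_nonneg (hη.nonneg x) _)
  have hV0 : 0 ≤ ∫ x, v x ^ p * η x ^ (n + 2) := integral_nonneg fun x =>
    mul_nonneg (Real.rpow_nonneg (h.v_pos x).le _) (pow_nonneg (hη.nonneg x) _)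
  generalize (∫ x, u x ^ q * η x ^ (n + 2)) = U at *
  generalize (∫ x, v x ^ p * η x ^ (n + 2)) = V at *
  generalize (∫ x, u x * η x ^ n) = U₁ at *
  generalize (∫ x, v x * η x ^ n) = V₁ at *
  generalize (∫ x, η x) = N at *
  have b1 : U ≤ 1 / 2 * V + C * (K * N) := by
    nlinarith [mul_le_mul_of_nonneg_left hv3 hC0, mul_le_mul_of_nonneg_right hCε hV0]
  have b2 : V ≤ 1 / 2 * U + C * (L * N) := by
    nlinarith [mul_le_mul_of_nonneg_left hu3 hC0, mul_le_mul_of_nonneg_right hCε hU0]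
  have b3 : U ≤ 2 * (C * (K * N) + C * (L * N)) := by linarith
  nlinarith [mul_le_mul_of_nonneg_left b3 hε0.le]

/-! ### Energy estimates for powers of a positive function. -/

section Energy

variable {d : ℕ} {w ζ : EuclideanSpace ℝ (Fin d) → ℝ}

theorem integral_rpow_mul_gradInner_self (hw : ContDiff ℝ 2 w) (hw0 : ∀ x, 0 < w x)
    (hζ : ContDiff ℝ 2 ζ) (hζs : HasCompactSupport ζ) {s : ℝ} (hs : 0 < s) :
    s * ∫ x, w x ^ (s - 1) * gradInner w w x * ζ x =
      (∫ x, -Δ w x * w x ^ s * ζ x) + 1 / (s + 1) * ∫ x, w x ^ (s + 1) * Δ ζ x := by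
  have hw1 : ContDiff ℝ 1 w := hw.of_le (by norm_num)
  have hζ1 : ContDiff ℝ 1 ζ := hζ.of_le (by norm_num)
  have hg : ContDiff ℝ 1 fun y => w y ^ s * ζ y := (contDiff_rpow hw1 hw0 s).mul hζ1
  have e1 := integral_mul_laplacian hw hg (Or.inr hζs.mul_left)
  have e2 := integral_mul_laplacian hζ (contDiff_rpow hw1 hw0 (s + 1)) (Or.inl hζs)
  have i1 : Integrable fun x => w x ^ (s - 1) * gradInner w w x * ζ x :=
    integrable_mul_of_hasCompactSupport ((contDiff_rpow hw1 hw0 _).continuous.mul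
      (continuous_gradInner hw1 hw1)) hζ.continuous hζs
  have i2 : Integrable fun x => gradInner (fun y => w y ^ (s + 1)) ζ x := by
    simp only [gradInner_comm (g := ζ)]
    exact (continuous_gradInner hζ1
      (contDiff_rpow hw1 hw0 _)).integrable_of_hasCompactSupport
      (hasCompactSupport_gradInner_left hζs)
  have e3 : ∫ x, gradInner (fun y => w y ^ s * ζ y) w x =
      s * (∫ x, w x ^ (s - 1) * gradInner w w x * ζ x)
        + 1 / (s + 1) * ∫ x, gradInner (fun y => w y ^ (s + 1)) ζ x := by
    rw [← integral_const_mul, ← integral_const_mul, ← integral_add (i1.const_mul _)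
      (i2.const_mul _)]
    congr 1 with x
    have dw := hw1.differentiable (by norm_num) x
    have dζ := hζ1.differentiable (by norm_num) x
    have dws := (contDiff_rpow hw1 hw0 s).differentiable (by norm_num) x
    rw [gradInner_comm, gradInner_mul_right dws dζ, gradInner_rpow_right s (hw0 x).ne' dw,
      gradInner_comm (f := fun y => w y ^ (s + 1)), gradInner_rpow_right (s + 1) (hw0 x).ne' dw,
      gradInner_comm (f := w) (g := ζ), add_sub_cancel_right]
    field_simp
    ring
  have e4 : ∫ x, w x ^ s * ζ x * Δ w x = -∫ x, -Δ w x * w x ^ s * ζ x := by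
    rw [← integral_neg]
    congr 1 with x
    ring
  rw [e4, e3, neg_inj] at e1
  rw [e1, e2]
  ring

theorem integral_gradInner_rpow_mul (hw : ContDiff ℝ 2 w) (hw0 : ∀ x, 0 < w x)
    (hζ : ContDiff ℝ 2 ζ) (hζs : HasCompactSupport ζ) (s : ℝ) :
    ∫ x, gradInner (fun y => w y ^ ((s + 1) / 2) * ζ y) (fun y => w y ^ ((s + 1) / 2) * ζ y) x =
      (s + 1) ^ 2 / 4 * (∫ x, w x ^ (s - 1) * gradInner w w x * ζ x ^ 2)
        - 1 / 2 * (∫ x, w x ^ (s + 1) * Δ (fun y => ζ y ^ 2) x)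
        + ∫ x, w x ^ (s + 1) * gradInner ζ ζ x := by
  have hw1 : ContDiff ℝ 1 w := hw.of_le (by norm_num)
  have hζ1 : ContDiff ℝ 1 ζ := hζ.of_le (by norm_num)
  have hζ2s : HasCompactSupport fun x => ζ x ^ 2 :=
    hζs.comp_left (g := fun t : ℝ => t ^ 2) (by simp)
  have e2 := integral_mul_laplacian (hζ.pow 2) (contDiff_rpow hw1 hw0 (s + 1)) (Or.inl hζ2s)
  have i1 : Integrable fun x => w x ^ (s - 1) * gradInner w w x * ζ x ^ 2 :=
    integrable_mul_of_hasCompactSupport ((contDiff_rpow hw1 hw0 _).continuous.mul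
      (continuous_gradInner hw1 hw1)) (hζ.continuous.pow 2) hζ2s
  have i2 : Integrable fun x => gradInner (fun y => w y ^ (s + 1)) (fun y => ζ y ^ 2) x := by
    simp only [gradInner_comm (g := fun y => ζ y ^ 2)]
    exact (continuous_gradInner (hζ1.pow 2)
      (contDiff_rpow hw1 hw0 _)).integrable_of_hasCompactSupport
      (hasCompactSupport_gradInner_left hζ2s)
  have i3 : Integrable fun x => w x ^ (s + 1) * gradInner ζ ζ x :=
    integrable_mul_of_hasCompactSupport (contDiff_rpow hw1 hw0 _).continuous
      (continuous_gradInner hζ1 hζ1) (hasCompactSupport_gradInner_left hζs)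
  rw [e2, mul_neg, sub_neg_eq_add, ← integral_const_mul, ← integral_const_mul,
    ← integral_add (i1.const_mul _) (i2.const_mul _),
    ← integral_add ((i1.const_mul _).fun_add (i2.const_mul _)) i3]
  congr 1 with x
  have dw := hw1.differentiable (by norm_num) x
  have dζ := hζ1.differentiable (by norm_num) x
  have dws := (contDiff_rpow hw1 hw0 ((s + 1) / 2)).differentiable (by norm_num) x
  have h0 := hw0 x
  simp only [gradInner, Finset.mul_sum, Finset.sum_mul, ← Finset.sum_add_distrib]
  refine Finset.sum_congr rfl fun i _ => ?_
  rw [partialDeriv_mul dws dζ, partialDeriv_rpow _ h0.ne' dw, partialDeriv_rpow _ h0.ne' dw,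
    partialDeriv_pow 2 dζ]
  have p1 : w x ^ (s + 1) = (w x ^ ((s + 1) / 2)) ^ 2 := by
    rw [← Real.rpow_natCast, ← Real.rpow_mul h0.le]; congr 1; push_cast; ring
  have p2 : w x ^ (s + 1 - 1) = w x ^ ((s + 1) / 2) * w x ^ ((s + 1) / 2 - 1) := by
    rw [← Real.rpow_add h0]; congr 1; ring
  have p3 : w x ^ (s - 1) = (w x ^ ((s + 1) / 2 - 1)) ^ 2 := by
    rw [← Real.rpow_natCast, ← Real.rpow_mul h0.le]; congr 1; push_cast; ring
  rw [p1, p2, p3]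
  push_cast
  ring

/-- The coefficient `(s + 1)² / (4s)` has to be kept exactly, since it decides the absorption; all
cutoff errors go into `C`. -/
theorem IsCutoff.exists_energy_bound {η : EuclideanSpace ℝ (Fin d) → ℝ} (hη : IsCutoff η) {n : ℕ}
    (hn : n ≠ 0) {s : ℝ} (hs : 0 < s) :
    ∃ C, 0 ≤ C ∧ ∀ {w : EuclideanSpace ℝ (Fin d) → ℝ}, ContDiff ℝ 2 w → (∀ x, 0 < w x) →
      (∫ x, w x ^ (s - 1) * gradInner w w x * η x ^ (2 * n + 2)) ≤
        1 / s * (∫ x, -Δ w x * w x ^ s * η x ^ (2 * n + 2))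
          + C * ∫ x, w x ^ (s + 1) * η x ^ (2 * n) ∧
      (∫ x, gradInner (fun y => w y ^ ((s + 1) / 2) * η y ^ (n + 1))
          (fun y => w y ^ ((s + 1) / 2) * η y ^ (n + 1)) x) ≤
        (s + 1) ^ 2 / (4 * s) * (∫ x, -Δ w x * w x ^ s * η x ^ (2 * n + 2))
          + C * ∫ x, w x ^ (s + 1) * η x ^ (2 * n) := by
  obtain ⟨C₁, hC₁0, hC₁⟩ := hη.exists_gradInner_pow_le n
  obtain ⟨C₂, hC₂0, hC₂⟩ := hη.exists_abs_laplacian_pow_le (2 * n)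
  refine ⟨C₂ / (s * (s + 1)) + (s + 1) / (4 * s) * C₂ + 1 / 2 * C₂ + C₁, by positivity,
    fun {w} hw hw0 => ?_⟩
  have hζ : ContDiff ℝ 2 fun y => η y ^ (n + 1) := hη.contDiff.pow _
  have hζs := hη.hasCompactSupport_pow (n := n + 1) (by omega)
  have hw1 : Continuous fun x => w x ^ (s + 1) := (contDiff_rpow hw hw0 _).continuous
  have e1 := integral_rpow_mul_gradInner_self hw hw0 (hη.contDiff.pow (2 * n + 2))
    (hη.hasCompactSupport_pow (by omega)) hs
  have e2 := integral_gradInner_rpow_mul hw hw0 hζ hζs s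
  have e3 : (fun y => (η y ^ (n + 1)) ^ 2) = fun y => η y ^ (2 * n + 2) := by
    ext y; ring
  simp only [funext_iff.1 e3] at e2
  have e4 := abs_le.1 (hη.abs_integral_mul_laplacian_le hC₂ hw1
    (fun x => (Real.rpow_pos_of_pos (hw0 x) _).le) (by omega))
  have e5 : ∫ x, w x ^ (s + 1) * gradInner (fun y => η y ^ (n + 1)) (fun y => η y ^ (n + 1)) x
      ≤ C₁ * ∫ x, w x ^ (s + 1) * η x ^ (2 * n) := by
    have h1 := hζ.of_le (show (1 : WithTop ℕ∞) ≤ 2 by norm_num)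
    rw [← integral_const_mul]
    refine integral_mono (integrable_mul_of_hasCompactSupport hw1 (continuous_gradInner h1 h1)
      (hasCompactSupport_gradInner_left hζs)) ((integrable_mul_of_hasCompactSupport hw1
      (hη.contDiff.continuous.pow _) (hη.hasCompactSupport_pow (by omega))).const_mul _) fun x => ?_
    calc _ ≤ w x ^ (s + 1) * (C₁ * η x ^ (2 * n)) :=
          mul_le_mul_of_nonneg_left (hC₁ x) (Real.rpow_pos_of_pos (hw0 x) _).le
      _ = _ := by ring
  have hE0 : 0 ≤ ∫ x, w x ^ (s + 1) * η x ^ (2 * n) := integral_nonneg fun x =>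
    mul_nonneg (Real.rpow_pos_of_pos (hw0 x) _).le (pow_nonneg (hη.nonneg x) _)
  generalize (∫ x, w x ^ (s + 1) * η x ^ (2 * n)) = E at *
  generalize (∫ x, w x ^ (s - 1) * gradInner w w x * η x ^ (2 * n + 2)) = G at *
  generalize (∫ x, -Δ w x * w x ^ s * η x ^ (2 * n + 2)) = I at *
  generalize (∫ x, w x ^ (s + 1) * Δ (fun y => η y ^ (2 * n + 2)) x) = D at *
  have hG : G = 1 / s * I + 1 / (s * (s + 1)) * D := by
    field_simp at e1 ⊢
    linarith
  have b1 : 1 / (s * (s + 1)) * D ≤ C₂ / (s * (s + 1)) * E := by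
    calc _ ≤ 1 / (s * (s + 1)) * (C₂ * E) := by gcongr; exact e4.2
      _ = _ := by ring
  have b2 : (s + 1) / (4 * s) * D ≤ (s + 1) / (4 * s) * C₂ * E := by
    rw [mul_assoc]; gcongr; exact e4.2
  have p1 : 0 ≤ C₂ / (s * (s + 1)) * E := by positivity
  have p2 : 0 ≤ (s + 1) / (4 * s) * C₂ * E := by positivity
  have p3 : 0 ≤ C₂ * E := by positivity
  have p4 : 0 ≤ C₁ * E := by positivity
  constructor
  · rw [hG]; linarith
  · rw [e2, hG]
    have : (s + 1) ^ 2 / 4 * (1 / s * I + 1 / (s * (s + 1)) * D) =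
        (s + 1) ^ 2 / (4 * s) * I + (s + 1) / (4 * s) * D := by field_simp
    rw [this]
    linarith

end Energy

/-! ### Interpolation, absorption and the resulting stability estimate. -/

theorem integral_le_of_le_add {α : Type*} [MeasurableSpace α] {μ : Measure α} {f g h : α → ℝ}
    {a b c : ℝ} (hf : Integrable f μ) (hg : Integrable g μ) (hh : Integrable h μ)
    (hle : ∀ x, c * h x ≤ a * f x + b * g x) :
    c * ∫ x, h x ∂μ ≤ a * (∫ x, f x ∂μ) + b * ∫ x, g x ∂μ := by
  rw [← integral_const_mul, ← integral_const_mul, ← integral_const_mul,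
    ← integral_add (hf.const_mul _) (hg.const_mul _)]
  exact integral_mono (hh.const_mul _) ((hf.const_mul _).add (hg.const_mul _)) hle

theorem rpow_mul_rpow_mul_rpow_le {θ r A B : ℝ} (hθ : 0 ≤ θ) (hθ1 : θ ≤ 1) (hr : 0 ≤ r)
    (hA : 0 ≤ A) (hB : 0 ≤ B) :
    r ^ θ * (A ^ (1 - θ) * B ^ θ) ≤ (1 - θ) * A + θ * r * B := by
  have := Real.geom_mean_le_arith_mean2_weighted (sub_nonneg.2 hθ1) hθ hA (mul_nonneg hr hB)
    (by ring)
  rw [Real.mul_rpow hr hB] at this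
  linarith

/-- Interpolation between the two exponent pairs that occur in the stability inequality. -/
theorem rpow_interpolate {p q s t θ a b : ℝ} (ha : 0 < a) (hb : 0 < b)
    (hθs : θ * (s + 1) = (q + 1) / 2) (hθt : θ * (t + 1) = (p + 1) / 2) :
    (a ^ ((q - 1) / 2) * b ^ ((p - 1) / 2) * a ^ (s + 1)) ^ (1 - θ) *
      (a ^ ((q - 1) / 2) * b ^ ((p - 1) / 2) * b ^ (t + 1)) ^ θ = b ^ p * a ^ s := by
  have a1 : a ^ s = a ^ ((q - 1) / 2 * (1 - θ)) * a ^ ((s + 1) * (1 - θ)) *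
      a ^ ((q - 1) / 2 * θ) := by
    rw [← Real.rpow_add ha, ← Real.rpow_add ha]; congr 1; linarith
  have a2 : b ^ p = b ^ ((p - 1) / 2 * (1 - θ)) * b ^ ((p - 1) / 2 * θ) *
      b ^ ((t + 1) * θ) := by
    rw [← Real.rpow_add hb, ← Real.rpow_add hb]; congr 1; linarith
  rw [a1, a2, Real.mul_rpow (by positivity) (by positivity),
    Real.mul_rpow (by positivity) (by positivity), Real.mul_rpow (by positivity)
    (by positivity), Real.mul_rpow (by positivity) (by positivity)]
  simp only [← Real.rpow_mul ha.le, ← Real.rpow_mul hb.le]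
  ring

/-- Absorption of the interpolated terms, `ρ / k < 1` being the relevant contraction factor. -/
theorem absorb_interpolation {A B I₁ I₂ E F C₁ C₂ κ₁ κ₂ k ρ y r θ : ℝ} (hA : 0 ≤ A) (hB : 0 ≤ B)
    (hy : 0 < y) (hr : 0 < r) (hθ : 0 ≤ θ) (hθ1 : θ ≤ 1) (hκ₁ : 0 ≤ κ₁) (hρ : 0 < ρ)
    (hρk : ρ < k) (hy1 : κ₁ * y⁻¹ = ρ) (hy2 : κ₂ * y = ρ)
    (hsA : k * A ≤ κ₁ * I₁ + C₁ * E) (hsB : k * B ≤ κ₂ * I₂ + C₂ * F)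
    (h1 : y * I₁ ≤ (1 - θ) * A + θ * r * B) (h2 : r / y * I₂ ≤ θ * A + (1 - θ) * r * B) :
    I₁ ≤ y⁻¹ * ((C₁ * E + r * (C₂ * F)) / (k - ρ)) := by
  have hkρ : 0 < k - ρ := by linarith
  have hκ₂ : 0 < κ₂ := pos_of_mul_pos_left (hy2 ▸ hρ) hy.le
  have c1 : κ₁ * I₁ ≤ ρ * ((1 - θ) * A + θ * r * B) := by
    rw [← hy1]
    calc κ₁ * I₁ = κ₁ * y⁻¹ * (y * I₁) := by field_simp
      _ ≤ _ := by gcongr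
  have c2 : r * (κ₂ * I₂) ≤ ρ * (θ * A + (1 - θ) * r * B) := by
    rw [← hy2]
    calc r * (κ₂ * I₂) = κ₂ * y * (r / y * I₂) := by field_simp
      _ ≤ _ := by gcongr
  -- Adding `c1` and `c2`, the weights `θ` and `1 - θ` sum to one and leave exactly `ρ (A + r B)`.
  have c3 : A + r * B ≤ (C₁ * E + r * (C₂ * F)) / (k - ρ) := by
    rw [le_div_iff₀ hkρ]
    have b1 := mul_le_mul_of_nonneg_left hsB hr.le
    linarith
  have c4 : (1 - θ) * A + θ * r * B ≤ A + r * B := by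
    have h3 : 0 ≤ θ * A := by positivity
    have h4 : 0 ≤ (1 - θ) * (r * B) := mul_nonneg (by linarith) (by positivity)
    linarith
  calc I₁ = y⁻¹ * (y * I₁) := by field_simp
    _ ≤ _ := by gcongr; exact h1.trans (c4.trans c3)

theorem IsPositiveStable.exists_stability_bound {d : ℕ} {p q s t : ℝ} (hq : 1 < q) (hpq : q ≤ p)
    (hs : q ≤ s) (hst : (t + 1) * (q + 1) = (s + 1) * (p + 1))
    (hlt : (s + 1) ^ 2 * (t + 1) ^ 2 < 16 * (p * q) * (s * t))
    {η : EuclideanSpace ℝ (Fin d) → ℝ} (hη : IsCutoff η) {n : ℕ} (hn : n ≠ 0) :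
    ∃ C, 0 ≤ C ∧ ∀ {u v φ ψ : EuclideanSpace ℝ (Fin d) → ℝ}, IsPositiveStable p q u v φ ψ →
      (∫ x, v x ^ p * u x ^ s * η x ^ (2 * n + 2)) ≤ C * (∫ x, u x ^ (s + 1) * η x ^ (2 * n)) ∧
      (∫ x, u x ^ (s - 1) * gradInner u u x * η x ^ (2 * n + 2)) ≤
        C * (∫ x, u x ^ (s + 1) * η x ^ (2 * n)) := by
  have hp : 1 < p := hq.trans_le hpq
  have hs0 : 0 < s := by linarith
  have ht0 : 0 < t := by nlinarith
  obtain ⟨l, hl0, hl⟩ := IsPositiveStable.exists_comparison hq hpq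
  obtain ⟨C₁, hC₁0, hC₁⟩ := hη.exists_energy_bound hn hs0
  obtain ⟨C₂, hC₂0, hC₂⟩ := hη.exists_energy_bound hn ht0
  set κ₁ := (s + 1) ^ 2 / (4 * s) with hκ₁
  set κ₂ := (t + 1) ^ 2 / (4 * t) with hκ₂
  have hκ₁0 : 0 < κ₁ := by positivity
  have hκ₂0 : 0 < κ₂ := by positivity
  set k := √(p * q) with hk
  set ρ := √(κ₁ * κ₂) with hρ
  have hρk : ρ < k := by
    refine Real.sqrt_lt_sqrt (by positivity) ?_
    rw [hκ₁, hκ₂, div_mul_div_comm, div_lt_iff₀ (by positivity)]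
    linarith
  have hρ0 : 0 < ρ := by positivity
  -- The factor `y` balances the two coefficients: `κ₁ / y = κ₂ y = ρ`.
  set y := κ₁ / ρ with hy
  have hy0 : 0 < y := by positivity
  have hy1 : κ₁ * y⁻¹ = ρ := by rw [hy]; field_simp
  have hy2 : κ₂ * y = ρ := by
    have : ρ * ρ = κ₁ * κ₂ := Real.mul_self_sqrt (by positivity)
    rw [hy, ← mul_div_assoc, div_eq_iff hρ0.ne', this]; ring
  -- The interpolation exponent; `hst` makes the same `θ` serve both `s` and `t`.
  set θ := (q + 1) / (2 * (s + 1)) with hθ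
  have hθ0 : 0 < θ := by positivity
  have hθ1 : θ ≤ 1 := by rw [hθ, div_le_one (by positivity)]; linarith
  have hθs : θ * (s + 1) = (q + 1) / 2 := by rw [hθ]; field_simp
  have hθt : θ * (t + 1) = (p + 1) / 2 := by
    rw [hθ, div_mul_eq_mul_div, mul_comm, hst]; field_simp
  set r := y ^ (1 / θ) with hr
  have hr0 : 0 < r := by positivity
  have hrθ : r ^ θ = y := by
    rw [hr, ← Real.rpow_mul hy0.le, one_div_mul_cancel hθ0.ne', Real.rpow_one]
  have hr1 : r ^ (1 - θ) = r / y := by rw [Real.rpow_sub hr0, Real.rpow_one, hrθ]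
  set σ := (q + 1) / (p + 1) with hσ
  have hσt : σ * (t + 1) = s + 1 := by
    rw [hσ, div_mul_eq_mul_div, div_eq_iff (by positivity)]; linarith
  set D := (C₁ + r * C₂ * l ^ (t + 1)) / (k - ρ) with hD
  have hkρ : 0 < k - ρ := by linarith
  have hD0 : 0 ≤ D := by positivity
  refine ⟨y⁻¹ * D + (1 / s * (y⁻¹ * D) + C₁), by positivity, fun {u v φ ψ} h => ?_⟩
  have hu := h.u_pos
  have hv := h.v_pos
  have huc : ∀ a : ℝ, Continuous fun x => u x ^ a := fun a =>
    (contDiff_rpow h.contDiff_u hu a).continuous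
  have hvc : ∀ a : ℝ, Continuous fun x => v x ^ a := fun a =>
    (contDiff_rpow h.contDiff_v hv a).continuous
  have hηi : ∀ {f : EuclideanSpace ℝ (Fin d) → ℝ} {m : ℕ}, Continuous f → m ≠ 0 →
      Integrable fun x => f x * η x ^ m := fun hf hm =>
    integrable_mul_of_hasCompactSupport hf (hη.contDiff.continuous.pow _)
      (hη.hasCompactSupport_pow hm)
  have stab : ∀ {w : EuclideanSpace ℝ (Fin d) → ℝ} (a : ℝ), ContDiff ℝ 2 w → (∀ x, 0 < w x) →
      k * (∫ x, u x ^ ((q - 1) / 2) * v x ^ ((p - 1) / 2) * w x ^ (a + 1) * η x ^ (2 * n + 2)) ≤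
      ∫ x, gradInner (fun y => w y ^ ((a + 1) / 2) * η y ^ (n + 1))
        (fun y => w y ^ ((a + 1) / 2) * η y ^ (n + 1)) x := by
    intro w a hw hw0
    have hγ : ContDiff ℝ 2 fun y => w y ^ ((a + 1) / 2) * η y ^ (n + 1) :=
      (contDiff_rpow hw hw0 _).mul (hη.contDiff.pow _)
    refine le_trans (le_of_eq ?_) (h.integral_le (by linarith) (by linarith)
      (hγ.of_le (by norm_num)) (hη.hasCompactSupport_pow (by omega)).mul_left)
    congr 2 with x
    have : w x ^ (a + 1) = (w x ^ ((a + 1) / 2)) ^ 2 := by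
      rw [← Real.rpow_natCast, ← Real.rpow_mul (hw0 x).le]; congr 1; push_cast; ring
    rw [this]
    ring
  have sA := (stab s h.contDiff_u hu).trans (hC₁ h.contDiff_u hu).2
  have sB := (stab t h.contDiff_v hv).trans (hC₂ h.contDiff_v hv).2
  have sG := (hC₁ h.contDiff_u hu).1
  simp only [h.laplacian_u, h.laplacian_v, neg_neg] at sA sB sG
  -- The pointwise comparison enters here, with `σ (t + 1) = s + 1`.
  have hEv : ∫ x, v x ^ (t + 1) * η x ^ (2 * n) ≤
      l ^ (t + 1) * ∫ x, u x ^ (s + 1) * η x ^ (2 * n) := by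
    rw [← integral_const_mul]
    refine integral_mono (hηi (hvc _) (by omega)) ((hηi (huc _) (by omega)).const_mul _)
      fun x => ?_
    simp only [← mul_assoc]
    refine mul_le_mul_of_nonneg_right ?_ (pow_nonneg (hη.nonneg x) _)
    calc v x ^ (t + 1) ≤ (l * u x ^ σ) ^ (t + 1) :=
          Real.rpow_le_rpow (hv x).le (hl h x) (by linarith)
      _ = _ := by
          rw [Real.mul_rpow hl0.le (Real.rpow_pos_of_pos (hu x) _).le, ← Real.rpow_mul (hu x).le,
            hσt]
  have iA := hηi (m := 2 * n + 2) (((huc ((q - 1) / 2)).fun_mul (hvc ((p - 1) / 2))).fun_mul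
    (huc (s + 1))) (by omega)
  have iB := hηi (m := 2 * n + 2) (((huc ((q - 1) / 2)).fun_mul (hvc ((p - 1) / 2))).fun_mul
    (hvc (t + 1))) (by omega)
  have i1 := hηi (m := 2 * n + 2) ((hvc p).fun_mul (huc s)) (by omega)
  have i2 := hηi (m := 2 * n + 2) ((huc q).fun_mul (hvc t)) (by omega)
  have young1 : y * (∫ x, v x ^ p * u x ^ s * η x ^ (2 * n + 2)) ≤
      (1 - θ) * (∫ x, u x ^ ((q - 1) / 2) * v x ^ ((p - 1) / 2) * u x ^ (s + 1)
        * η x ^ (2 * n + 2)) + θ * r * (∫ x, u x ^ ((q - 1) / 2) * v x ^ ((p - 1) / 2)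
        * v x ^ (t + 1) * η x ^ (2 * n + 2)) := by
    refine integral_le_of_le_add iA iB i1 fun x => ?_
    have hu := hu x
    have hv := hv x
    have := rpow_mul_rpow_mul_rpow_le hθ0.le hθ1 hr0.le
      (by positivity : 0 ≤ u x ^ ((q - 1) / 2) * v x ^ ((p - 1) / 2) * u x ^ (s + 1))
      (by positivity : 0 ≤ u x ^ ((q - 1) / 2) * v x ^ ((p - 1) / 2) * v x ^ (t + 1))
    rw [rpow_interpolate hu hv hθs hθt, hrθ] at this
    have := mul_le_mul_of_nonneg_right this (pow_nonneg (hη.nonneg x) (2 * n + 2))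
    simpa only [add_mul, mul_assoc] using this
  have young2 : r / y * (∫ x, u x ^ q * v x ^ t * η x ^ (2 * n + 2)) ≤
      θ * (∫ x, u x ^ ((q - 1) / 2) * v x ^ ((p - 1) / 2) * u x ^ (s + 1)
        * η x ^ (2 * n + 2)) + (1 - θ) * r * (∫ x, u x ^ ((q - 1) / 2) * v x ^ ((p - 1) / 2)
        * v x ^ (t + 1) * η x ^ (2 * n + 2)) := by
    refine integral_le_of_le_add iA iB i2 fun x => ?_
    have hu := hu x
    have hv := hv x
    have := rpow_mul_rpow_mul_rpow_le (by linarith : 0 ≤ 1 - θ) (by linarith) hr0.le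
      (by positivity : 0 ≤ u x ^ ((q - 1) / 2) * v x ^ ((p - 1) / 2) * u x ^ (s + 1))
      (by positivity : 0 ≤ u x ^ ((q - 1) / 2) * v x ^ ((p - 1) / 2) * v x ^ (t + 1))
    have e := rpow_interpolate hv hu hθt hθs
    rw [mul_comm (v x ^ ((p - 1) / 2))] at e
    rw [sub_sub_cancel, hr1, mul_comm ((_ : ℝ) ^ θ), e] at this
    have := mul_le_mul_of_nonneg_right this (pow_nonneg (hη.nonneg x) (2 * n + 2))
    simpa only [add_mul, mul_assoc] using this
  have hA0 : 0 ≤ ∫ x, u x ^ ((q - 1) / 2) * v x ^ ((p - 1) / 2) * u x ^ (s + 1)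
      * η x ^ (2 * n + 2) := integral_nonneg fun x => by
    have := hu x; have := hv x; have := hη.nonneg x; positivity
  have hB0 : 0 ≤ ∫ x, u x ^ ((q - 1) / 2) * v x ^ ((p - 1) / 2) * v x ^ (t + 1)
      * η x ^ (2 * n + 2) := integral_nonneg fun x => by
    have := hu x; have := hv x; have := hη.nonneg x; positivity
  have hE0 : 0 ≤ ∫ x, u x ^ (s + 1) * η x ^ (2 * n) := integral_nonneg fun x => by
    have := hu x; have := hη.nonneg x; positivity
  generalize (∫ x, u x ^ ((q - 1) / 2) * v x ^ ((p - 1) / 2) * u x ^ (s + 1)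
      * η x ^ (2 * n + 2)) = A at *
  generalize (∫ x, u x ^ ((q - 1) / 2) * v x ^ ((p - 1) / 2) * v x ^ (t + 1)
      * η x ^ (2 * n + 2)) = B at *
  generalize (∫ x, v x ^ p * u x ^ s * η x ^ (2 * n + 2)) = I₁ at *
  generalize (∫ x, u x ^ q * v x ^ t * η x ^ (2 * n + 2)) = I₂ at *
  generalize (∫ x, u x ^ (s + 1) * η x ^ (2 * n)) = E at *
  generalize (∫ x, v x ^ (t + 1) * η x ^ (2 * n)) = Ev at *
  generalize (∫ x, u x ^ (s - 1) * gradInner u u x * η x ^ (2 * n + 2)) = G at *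
  have c4 : I₁ ≤ y⁻¹ * D * E := by
    refine (absorb_interpolation hA0 hB0 hy0 hr0 hθ0.le hθ1 hκ₁0.le hρ0 hρk hy1 hy2 sA sB young1
      young2).trans ?_
    rw [hD, mul_assoc, div_mul_eq_mul_div]
    gcongr
    have := mul_le_mul_of_nonneg_left hEv (mul_nonneg hr0.le hC₂0)
    linarith only [this]
  have c5 : 1 / s * I₁ ≤ 1 / s * (y⁻¹ * D * E) := by gcongr
  have q1 : 0 ≤ y⁻¹ * D * E := by positivity
  have q2 : 0 ≤ 1 / s * (y⁻¹ * D * E) := by positivity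
  have q3 : 0 ≤ C₁ * E := by positivity
  exact ⟨by linarith only [c4, q2, q3], by linarith only [sG, c5, q1]⟩

/-! ### Sobolev and Hölder inequalities. -/

theorem norm_fderiv_le_sum_abs_partialDeriv {d : ℕ} (f : EuclideanSpace ℝ (Fin d) → ℝ)
    (x : EuclideanSpace ℝ (Fin d)) : ‖fderiv ℝ f x‖ ≤ ∑ i, |partialDeriv i f x| := by
  refine ContinuousLinearMap.opNorm_le_bound _ (Finset.sum_nonneg fun _ _ => abs_nonneg _)
    fun y => ?_
  have hy : y = ∑ i, y i • EuclideanSpace.single i (1 : ℝ) := by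
    simpa using ((EuclideanSpace.basisFun (Fin d) ℝ).sum_repr y).symm
  have e : fderiv ℝ f x y = ∑ i, y i * partialDeriv i f x := by
    conv_lhs => rw [hy]
    simp [partialDeriv]
  rw [e, Finset.sum_mul]
  refine (norm_sum_le _ _).trans (Finset.sum_le_sum fun i _ => ?_)
  rw [norm_mul, mul_comm, Real.norm_eq_abs]
  gcongr
  exact PiLp.norm_apply_le y i

/-- The Gagliardo–Nirenberg–Sobolev inequality for `W^{1,1}`, with real integrals. -/
theorem exists_sobolev_bound {d : ℕ} (hd : 2 ≤ d) :
    ∃ κ : ℝ, 1 < κ ∧ ∃ S : ℝ, 0 ≤ S ∧ ∀ f : EuclideanSpace ℝ (Fin d) → ℝ, ContDiff ℝ 1 f →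
      HasCompactSupport f → (∀ x, 0 ≤ f x) →
      (∫ x, f x ^ κ) ^ (1 / κ) ≤ S * ∫ x, ∑ i, |partialDeriv i f x| := by
  have hd' : (1 : NNReal) < Module.finrank ℝ (EuclideanSpace ℝ (Fin d)) := by
    rw [finrank_euclideanSpace_fin]; exact_mod_cast hd
  obtain ⟨κ, hconj⟩ : ∃ κ : NNReal, NNReal.HolderConjugate
      (Module.finrank ℝ (EuclideanSpace ℝ (Fin d))) κ :=
    ⟨_, NNReal.HolderConjugate.conjExponent hd'⟩
  have hκ1 : 1 < κ := hconj.symm.lt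
  set S := eLpNormLESNormFDerivOneConst (volume : Measure (EuclideanSpace ℝ (Fin d))) κ
  refine ⟨κ, by exact_mod_cast hκ1, S, S.coe_nonneg, fun f hf hfs hf0 => ?_⟩
  have h := eLpNorm_le_eLpNorm_fderiv_one (volume : Measure (EuclideanSpace ℝ (Fin d))) hf hfs hconj
  have hκ0 : (κ : ENNReal) ≠ 0 := by
    simpa using (zero_lt_one.trans hκ1).ne'
  have hm : MemLp f κ := hf.continuous.memLp_of_hasCompactSupport hfs
  have hfd : Continuous (fderiv ℝ f) := hf.continuous_fderiv (by norm_num)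
  have hfi : Integrable (fderiv ℝ f) := hfd.integrable_of_hasCompactSupport (hfs.fderiv ℝ)
  rw [hm.eLpNorm_eq_integral_rpow_norm hκ0 ENNReal.coe_ne_top,
    (memLp_one_iff_integrable.2 hfi).eLpNorm_eq_integral_rpow_norm one_ne_zero ENNReal.one_ne_top,
    ← ENNReal.ofReal_coe_nnreal (p := S), ← ENNReal.ofReal_mul S.coe_nonneg] at h
  rw [ENNReal.ofReal_le_ofReal_iff (by positivity)] at h
  simp only [ENNReal.coe_toReal, ENNReal.toReal_one, Real.rpow_one, inv_one,
    Real.norm_of_nonneg (hf0 _)] at h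
  rw [one_div]
  refine h.trans (mul_le_mul_of_nonneg_left ?_ S.coe_nonneg)
  refine integral_mono hfi.norm (integrable_finsetSum _ fun i _ => ?_)
    (norm_fderiv_le_sum_abs_partialDeriv f)
  exact ((continuous_partialDeriv hf i).integrable_of_hasCompactSupport
    (hasCompactSupport_partialDeriv hfs i)).abs

theorem IsCutoff.exists_integral_abs_partialDeriv_le {d : ℕ} {η : EuclideanSpace ℝ (Fin d) → ℝ}
    (hη : IsCutoff η) {n : ℕ} (hn : n ≠ 0) {s : ℝ} (hs : 0 < s) :
    ∃ C, 0 ≤ C ∧ ∀ {w : EuclideanSpace ℝ (Fin d) → ℝ}, ContDiff ℝ 2 w → (∀ x, 0 < w x) →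
      (∫ x, ∑ i, |partialDeriv i (fun y => w y ^ (s + 1) * η y ^ (2 * n + 2)) x|) ≤
        (s + 1) / 2 * (∫ x, w x ^ (s - 1) * gradInner w w x * η x ^ (2 * n + 2))
          + C * ∫ x, w x ^ (s + 1) * η x ^ (2 * n) := by
  obtain ⟨C, hC0, hC⟩ := hη.exists_abs_partialDeriv_pow_le (2 * n + 1)
  refine ⟨d * ((s + 1) / 2 + C), by positivity, fun {w} hw hw0 => ?_⟩
  have hw1 : ContDiff ℝ 1 w := hw.of_le (by norm_num)
  have hη1 : ContDiff ℝ 1 η := hη.contDiff.of_le (by norm_num)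
  have hf : ContDiff ℝ 1 fun y => w y ^ (s + 1) * η y ^ (2 * n + 2) :=
    (contDiff_rpow hw1 hw0 _).mul (hη1.pow _)
  have hfs : HasCompactSupport fun y => w y ^ (s + 1) * η y ^ (2 * n + 2) :=
    (hη.hasCompactSupport_pow (by omega)).mul_left
  have i0 : Integrable fun x =>
      ∑ i, |partialDeriv i (fun y => w y ^ (s + 1) * η y ^ (2 * n + 2)) x| :=
    integrable_finsetSum _ fun i _ =>
      ((continuous_partialDeriv hf i).integrable_of_hasCompactSupport
        (hasCompactSupport_partialDeriv hfs i)).abs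
  have i1 : Integrable fun x => w x ^ (s - 1) * gradInner w w x * η x ^ (2 * n + 2) :=
    integrable_mul_of_hasCompactSupport ((contDiff_rpow hw1 hw0 _).continuous.mul
      (continuous_gradInner hw1 hw1)) (hη1.continuous.pow _) (hη.hasCompactSupport_pow (by omega))
  have i2 : Integrable fun x => w x ^ (s + 1) * η x ^ (2 * n) :=
    integrable_mul_of_hasCompactSupport (contDiff_rpow hw1 hw0 _).continuous
      (hη1.continuous.pow _) (hη.hasCompactSupport_pow (by omega))
  have := integral_le_of_le_add (a := (s + 1) / 2) (b := d * ((s + 1) / 2 + C)) (c := 1) i1 i2 i0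
    fun x => ?_
  · rwa [one_mul] at this
  have h0 := hw0 x
  have e0 := hη.nonneg x
  have hle1 : η x ^ (2 * n + 2) ≤ η x ^ (2 * n) :=
    pow_le_pow_of_le_one e0 (hη.le_one x) (by omega)
  have hle2 : η x ^ (2 * n + 1) ≤ η x ^ (2 * n) :=
    pow_le_pow_of_le_one e0 (hη.le_one x) (by omega)
  have key : ∀ i, |partialDeriv i (fun y => w y ^ (s + 1) * η y ^ (2 * n + 2)) x| ≤
      (s + 1) / 2 * (w x ^ (s - 1) * (partialDeriv i w x * partialDeriv i w x)
        * η x ^ (2 * n + 2)) + ((s + 1) / 2 + C) * (w x ^ (s + 1) * η x ^ (2 * n)) := by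
    intro i
    rw [partialDeriv_mul (f := fun y => w y ^ (s + 1)) (g := fun y => η y ^ (2 * n + 2))
      ((contDiff_rpow hw1 hw0 _).differentiable (by norm_num) x)
      ((hη1.pow _).differentiable (by norm_num) x),
      partialDeriv_rpow _ h0.ne' (hw1.differentiable (by norm_num) x), add_sub_cancel_right]
    have p1 : w x ^ (s + 1) = w x ^ (s - 1) * w x ^ 2 := by
      rw [← Real.rpow_natCast, ← Real.rpow_add h0]; congr 1; push_cast; ring
    have p2 : w x ^ s = w x ^ (s - 1) * w x := by
      rw [Real.rpow_sub_one h0.ne']; field_simp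
    have a1 : |w x ^ (s + 1) * partialDeriv i (fun y => η y ^ (2 * n + 2)) x| ≤
        C * (w x ^ (s + 1) * η x ^ (2 * n)) := by
      rw [abs_mul, abs_of_pos (Real.rpow_pos_of_pos h0 _)]
      calc _ ≤ w x ^ (s + 1) * (C * η x ^ (2 * n + 1)) := by gcongr; exact hC i x
        _ ≤ w x ^ (s + 1) * (C * η x ^ (2 * n)) := by gcongr
        _ = _ := by ring
    have a2 : |η x ^ (2 * n + 2) * ((s + 1) * w x ^ s * partialDeriv i w x)| ≤
        (s + 1) / 2 * (w x ^ (s - 1) * (partialDeriv i w x * partialDeriv i w x)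
        * η x ^ (2 * n + 2)) + (s + 1) / 2 * (w x ^ (s + 1) * η x ^ (2 * n)) := by
      -- Young's inequality splits `w^s |∂ᵢw|` into the energy density `w^(s-1) |∂ᵢw|²` and
      -- `w^(s+1)`.
      have b1 : |w x * partialDeriv i w x| ≤
          1 / 2 * (partialDeriv i w x * partialDeriv i w x) + 1 / 2 * w x ^ 2 := by
        rw [abs_le]
        constructor <;> nlinarith [sq_nonneg (w x + partialDeriv i w x),
          sq_nonneg (w x - partialDeriv i w x)]
      calc |η x ^ (2 * n + 2) * ((s + 1) * w x ^ s * partialDeriv i w x)|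
          = (s + 1) * w x ^ (s - 1) * η x ^ (2 * n + 2) * |w x * partialDeriv i w x| := by
            rw [p2, ← abs_of_nonneg (by positivity :
              0 ≤ (s + 1) * w x ^ (s - 1) * η x ^ (2 * n + 2)), ← abs_mul]
            congr 1; ring
        _ ≤ (s + 1) * w x ^ (s - 1) * η x ^ (2 * n + 2) *
            (1 / 2 * (partialDeriv i w x * partialDeriv i w x) + 1 / 2 * w x ^ 2) := by gcongr
        _ = (s + 1) / 2 * (w x ^ (s - 1) * (partialDeriv i w x * partialDeriv i w x)
            * η x ^ (2 * n + 2)) + (s + 1) / 2 * (w x ^ (s + 1) * η x ^ (2 * n + 2)) := by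
            rw [p1]; ring
        _ ≤ _ := by gcongr
    refine (abs_add_le _ _).trans ?_
    linarith
  rw [one_mul]
  refine (Finset.sum_le_sum fun i _ => key i).trans (le_of_eq ?_)
  rw [Finset.sum_add_distrib, Finset.sum_const, Finset.card_univ, Fintype.card_fin, nsmul_eq_mul,
    gradInner, ← Finset.mul_sum, ← Finset.sum_mul, ← Finset.mul_sum]
  ring

/-- Hölder's inequality in the form `∫ f^θ g^(1-θ) ≤ (∫ f)^θ (∫ g)^(1-θ)` for continuous functions
of compact support. -/
theorem integral_rpow_mul_rpow_le {d : ℕ} {f g : EuclideanSpace ℝ (Fin d) → ℝ} {θ : ℝ}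
    (hθ : 0 < θ) (hθ1 : θ < 1) (hf : Continuous f) (hg : Continuous g) (hf0 : ∀ x, 0 ≤ f x)
    (hg0 : ∀ x, 0 ≤ g x) (hfs : HasCompactSupport f) (hgs : HasCompactSupport g) :
    ∫ x, f x ^ θ * g x ^ (1 - θ) ≤ (∫ x, f x) ^ θ * (∫ x, g x) ^ (1 - θ) := by
  have hθ2 : 0 < 1 - θ := by linarith
  have hconj : (1 / θ).HolderConjugate (1 / (1 - θ)) := by
    rw [Real.holderConjugate_iff]
    exact ⟨by rw [lt_div_iff₀ hθ]; linarith, by simp⟩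
  have m : ∀ {F : EuclideanSpace ℝ (Fin d) → ℝ} {a : ℝ} (b : ENNReal), 0 < a → Continuous F →
      HasCompactSupport F → MemLp (fun x => F x ^ a) b volume := by
    intro F a b ha hF hFs
    exact (hF.rpow_const fun x => Or.inr ha.le).memLp_of_hasCompactSupport
      (hFs.comp_left (g := fun t : ℝ => t ^ a) (Real.zero_rpow ha.ne'))
  have := integral_mul_le_Lp_mul_Lq_of_nonneg hconj
    (Eventually.of_forall fun x => Real.rpow_nonneg (hf0 x) θ)
    (Eventually.of_forall fun x => Real.rpow_nonneg (hg0 x) (1 - θ))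
    (m (ENNReal.ofReal (1 / θ)) hθ hf hfs) (m (ENNReal.ofReal (1 / (1 - θ))) hθ2 hg hgs)
  refine this.trans (le_of_eq ?_)
  simp only [← Real.rpow_mul (hf0 _), ← Real.rpow_mul (hg0 _), mul_one_div_cancel hθ.ne',
    mul_one_div_cancel hθ2.ne', Real.rpow_one, one_div_one_div]

/-! ### Uniform bound and the Liouville theorem. -/

/-- The scale-free a priori bound. -/
theorem IsPositiveStable.exists_uniform_bound {d : ℕ} (hd : 2 ≤ d) {p q s t : ℝ} (hq : 1 < q)
    (hpq : q ≤ p) (hs : q ≤ s) (hst : (t + 1) * (q + 1) = (s + 1) * (p + 1))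
    (hlt : (s + 1) ^ 2 * (t + 1) ^ 2 < 16 * (p * q) * (s * t))
    {η : EuclideanSpace ℝ (Fin d) → ℝ} (hη : IsCutoff η) :
    ∃ (n : ℕ) (C : ℝ), ∀ {u v φ ψ : EuclideanSpace ℝ (Fin d) → ℝ}, IsPositiveStable p q u v φ ψ →
      ∫ x, v x ^ p * u x ^ s * η x ^ (2 * n + 2) ≤ C := by
  have hp : 1 < p := hq.trans_le hpq
  have hs0 : 0 < s := by linarith
  obtain ⟨j, hj, C₀, hC₀⟩ := exists_integral_bound hp hq hη
  obtain ⟨κ, hκ, S, hS0, hS⟩ := exists_sobolev_bound hd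
  have hden : 0 < (s + 1) * κ - 1 := by nlinarith
  -- Solves `θ · 1 + (1 - θ)(s + 1)κ = s + 1`, interpolating the exponent `s + 1` between `1` and
  -- `(s + 1)κ`.
  set θ := ((s + 1) * κ - (s + 1)) / ((s + 1) * κ - 1) with hθ
  have hθ0 : 0 < θ := div_pos (by nlinarith) hden
  have hθ1 : θ < 1 := by rw [hθ, div_lt_one hden]; linarith
  have hθs : θ + (s + 1) * κ * (1 - θ) = s + 1 := by
    have : θ * ((s + 1) * κ - 1) = (s + 1) * κ - (s + 1) := div_mul_cancel₀ _ hden.ne'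
    linarith
  set ρ := κ * (1 - θ) with hρ
  have hρ0 : 0 < ρ := mul_pos (by linarith) (by linarith)
  have hρ1 : ρ < 1 := by
    have : (s + 1) * ρ = s + 1 - θ := by rw [hρ]; linarith
    nlinarith
  -- Since `ρ < 1`, a large `n` makes the cutoff power `jθ + (2n + 2)ρ` produced by interpolation at
  -- most `2n`.
  obtain ⟨n₀, hn₀⟩ := exists_nat_ge ((θ * j + 2 * ρ) / (2 * (1 - ρ)))
  rw [div_le_iff₀ (by linarith)] at hn₀
  set n := n₀ + 1 with hn
  have hnj : j * θ + (2 * n + 2) * ρ ≤ 2 * n := by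
    rw [hn]; push_cast; nlinarith
  obtain ⟨C₁, hC₁0, hC₁⟩ := IsPositiveStable.exists_stability_bound hq hpq hs hst hlt hη
    n₀.succ_ne_zero
  obtain ⟨C₂, hC₂0, hC₂⟩ := hη.exists_integral_abs_partialDeriv_le n₀.succ_ne_zero hs0
  set T := S * ((s + 1) / 2 * C₁ + C₂) with hT
  have hT0 : 0 ≤ T := by positivity
  refine ⟨n, C₁ * (|C₀| ^ θ * T ^ ρ) ^ (1 / (1 - ρ)), fun {u v φ ψ} h => ?_⟩
  have hu := h.u_pos
  have huc : Continuous fun x => u x ^ (s + 1) := (contDiff_rpow h.contDiff_u hu _).continuous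
  have hηc := hη.contDiff.continuous
  set f : EuclideanSpace ℝ (Fin d) → ℝ := fun y => u y ^ (s + 1) * η y ^ (2 * n + 2) with hf
  have hf1 : ContDiff ℝ 1 f := (contDiff_rpow (h.contDiff_u.of_le (by norm_num)) hu _).mul
    ((hη.contDiff.of_le (by norm_num)).pow _)
  have hf0 : ∀ x, 0 ≤ f x := fun x =>
    mul_nonneg (Real.rpow_pos_of_pos (hu x) _).le (pow_nonneg (hη.nonneg x) _)
  have hfs : HasCompactSupport f := (hη.hasCompactSupport_pow (by omega)).mul_left
  obtain ⟨b1, b2⟩ := hC₁ h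
  have b3 := hC₂ h.contDiff_u hu
  have b4 := hS f hf1 hfs hf0
  set E := ∫ x, u x ^ (s + 1) * η x ^ (2 * n) with hE
  have hE0 : 0 ≤ E := integral_nonneg fun x =>
    mul_nonneg (Real.rpow_pos_of_pos (hu x) _).le (pow_nonneg (hη.nonneg x) _)
  have b5 : (∫ x, f x ^ κ) ^ (1 / κ) ≤ T * E := by
    refine b4.trans ?_
    rw [hT, mul_assoc]
    refine mul_le_mul_of_nonneg_left (b3.trans ?_) hS0
    have := mul_le_mul_of_nonneg_left b2 (by positivity : 0 ≤ (s + 1) / 2)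
    linarith only [this]
  have hY0 : 0 ≤ ∫ x, f x ^ κ := integral_nonneg fun x => Real.rpow_nonneg (hf0 x) _
  have b6 : (∫ x, f x ^ κ) ^ (1 - θ) ≤ T ^ ρ * E ^ ρ := by
    calc (∫ x, f x ^ κ) ^ (1 - θ) = ((∫ x, f x ^ κ) ^ (1 / κ)) ^ ρ := by
          rw [← Real.rpow_mul hY0, hρ]; congr 1; field_simp
      _ ≤ (T * E) ^ ρ := Real.rpow_le_rpow (Real.rpow_nonneg hY0 _) b5 hρ0.le
      _ = _ := Real.mul_rpow hT0 hE0
  have hfκc : Continuous fun x => f x ^ κ := hf1.continuous.rpow_const fun x => Or.inr (by linarith)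
  have hfκs : HasCompactSupport fun x => f x ^ κ :=
    hfs.comp_left (g := fun t : ℝ => t ^ κ) (Real.zero_rpow (by linarith))
  have hjc : Continuous fun x => u x * η x ^ j := h.contDiff_u.continuous.mul (hηc.pow _)
  have hjs : HasCompactSupport fun x => u x * η x ^ j := (hη.hasCompactSupport_pow hj).mul_left
  have hj0 : ∀ x, 0 ≤ u x * η x ^ j := fun x => mul_nonneg (hu x).le (pow_nonneg (hη.nonneg x) _)
  have b7 := integral_rpow_mul_rpow_le hθ0 hθ1 hjc hfκc hj0
    (fun x => Real.rpow_nonneg (hf0 x) _) hjs hfκs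
  have b8 : E ≤ ∫ x, (u x * η x ^ j) ^ θ * (f x ^ κ) ^ (1 - θ) := by
    refine integral_mono (integrable_mul_of_hasCompactSupport huc (hηc.pow _)
      (hη.hasCompactSupport_pow (by omega))) (integrable_mul_of_hasCompactSupport
      (hjc.rpow_const fun x => Or.inr hθ0.le) (hfκc.rpow_const fun x => Or.inr (by linarith))
      (hfκs.comp_left (g := fun t : ℝ => t ^ (1 - θ)) (Real.zero_rpow (by linarith)))) fun x => ?_
    have h0 := hu x
    rcases (hη.nonneg x).eq_or_lt with e0 | e0
    · have : η x ^ (2 * n) = 0 := by rw [← e0]; exact zero_pow (by omega)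
      simp only [this, mul_zero]
      exact mul_nonneg (Real.rpow_nonneg (hj0 x) _)
        (Real.rpow_nonneg (Real.rpow_nonneg (hf0 x) _) _)
    · have e1 : (u x * η x ^ j) ^ θ * (f x ^ κ) ^ (1 - θ) =
          u x ^ (s + 1) * η x ^ (j * θ + (2 * n + 2) * ρ) := by
        rw [← Real.rpow_mul (hf0 x), ← hρ, hf]
        simp only
        rw [Real.mul_rpow h0.le (by positivity), Real.mul_rpow (by positivity) (by positivity),
          ← Real.rpow_natCast, ← Real.rpow_natCast, ← Real.rpow_mul e0.le, ← Real.rpow_mul e0.le,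
          ← Real.rpow_mul h0.le, Real.rpow_add e0]
        nth_rw 2 [← hθs]
        rw [Real.rpow_add h0, hρ]
        push_cast
        ring_nf
      simp only [e1]
      gcongr
      rw [← Real.rpow_natCast]
      exact Real.rpow_le_rpow_of_exponent_ge e0 (hη.le_one x) (by push_cast; exact hnj)
  -- The sublinear power `ρ < 1` is what bounds `E` independently of the solution.
  have b9 : E ≤ |C₀| ^ θ * T ^ ρ * E ^ ρ := by
    refine b8.trans (b7.trans ?_)
    rw [mul_assoc]
    refine mul_le_mul (Real.rpow_le_rpow (integral_nonneg hj0) ((hC₀ h).trans (le_abs_self _))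
      hθ0.le) b6 (Real.rpow_nonneg hY0 _) (by positivity)
  have b10 : E ≤ (|C₀| ^ θ * T ^ ρ) ^ (1 / (1 - ρ)) := by
    rcases hE0.eq_or_lt with e0 | e0
    · rw [← e0]; positivity
    · have h1 : E ^ (1 - ρ) ≤ |C₀| ^ θ * T ^ ρ := by
        rw [Real.rpow_sub e0, Real.rpow_one, div_le_iff₀ (by positivity)]
        exact b9
      calc E = (E ^ (1 - ρ)) ^ (1 / (1 - ρ)) := by
            rw [← Real.rpow_mul e0.le, mul_one_div_cancel (by linarith), Real.rpow_one]
        _ ≤ _ := Real.rpow_le_rpow (by positivity) h1 (by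
            have : 0 < 1 - ρ := by linarith
            positivity)
  exact b1.trans (mul_le_mul_of_nonneg_left b10 hC₁0)

/-- The Liouville theorem for an admissible test exponent. -/
theorem IsPositiveStable.false_of_exponent {d : ℕ} (hd : 2 ≤ d) {p q s t : ℝ} (hq : 1 < q)
    (hpq : q ≤ p) (hs : q ≤ s) (hst : (t + 1) * (q + 1) = (s + 1) * (p + 1))
    (hlt : (s + 1) ^ 2 * (t + 1) ^ 2 < 16 * (p * q) * (s * t))
    (hdim : (d : ℝ) < scalingAlpha p q * s + scalingBeta p q * p)
    {u v φ ψ : EuclideanSpace ℝ (Fin d) → ℝ} (h : IsPositiveStable p q u v φ ψ) : False := by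
  obtain ⟨η, hη⟩ := exists_isCutoff d
  obtain ⟨n, C, hC⟩ := IsPositiveStable.exists_uniform_bound hd hq hpq hs hst hlt hη
  have hpq1 : 1 < p * q := by nlinarith
  set B := Metric.closedBall (0 : EuclideanSpace ℝ (Fin d)) 1 with hB
  have hcont : Continuous fun x => v x ^ p * u x ^ s :=
    (contDiff_rpow h.contDiff_v h.v_pos _).continuous.mul
      (contDiff_rpow h.contDiff_u h.u_pos _).continuous
  have hpos : ∀ x, 0 < v x ^ p * u x ^ s := fun x =>
    mul_pos (Real.rpow_pos_of_pos (h.v_pos x) _) (Real.rpow_pos_of_pos (h.u_pos x) _)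
  set F := B.indicator fun x => v x ^ p * u x ^ s with hF
  have hBm : MeasurableSet B := Metric.isClosed_closedBall.measurableSet
  have hFi : Integrable F := (integrable_indicator_iff hBm).2
    (hcont.continuousOn.integrableOn_compact (isCompact_closedBall 0 1))
  have hFpos : 0 < ∫ x, F x := by
    rw [hF, integral_indicator hBm]
    refine (setIntegral_pos_iff_support_of_nonneg_ae (Eventually.of_forall fun x => (hpos x).le)
      (hcont.continuousOn.integrableOn_compact (isCompact_closedBall 0 1))).2 ?_
    rw [Function.support_eq_univ fun x => (hpos x).ne', univ_inter]
    exact Metric.measure_closedBall_pos _ _ one_pos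
  set δ := scalingAlpha p q * s + scalingBeta p q * p - d with hδ
  have hδ0 : 0 < δ := by rw [hδ]; linarith
  -- The constant `C` is common to all rescalings. For `R ≥ 1`, `x ↦ F (R • x)` is supported in the
  -- ball of radius `1/R`, where the cutoff equals 1.
  have hbound : ∀ R : ℝ, 1 ≤ R → R ^ δ * ∫ x, F x ≤ C := by
    intro R hR
    have hR0 : 0 < R := by linarith
    have h1 := hC (h.rescale hpq1 0 hR0)
    have h2 := h.rescale hpq1 0 hR0
    simp only [zero_add] at h1
    have e1 : ∫ x : EuclideanSpace ℝ (Fin d), F (R • x) = (R ^ d)⁻¹ * ∫ x, F x := by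
      rw [Measure.integral_comp_smul, finrank_euclideanSpace_fin, abs_of_pos (by positivity),
        smul_eq_mul]
    have e2 : R ^ δ * ∫ x, F x = ∫ x : EuclideanSpace ℝ (Fin d),
        R ^ (scalingAlpha p q * s + scalingBeta p q * p) * F (R • x) := by
      rw [integral_const_mul, e1, hδ, Real.rpow_sub hR0, Real.rpow_natCast]
      ring
    rw [e2]
    refine le_trans (integral_mono ?_ ?_ fun x => ?_) h1
    · exact ((integrable_comp_smul_iff volume F hR0.ne').2 hFi).const_mul _
    · have c1 := (contDiff_rpow h2.contDiff_v h2.v_pos p).continuous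
      have c2 := (contDiff_rpow h2.contDiff_u h2.u_pos s).continuous
      simp only [zero_add] at c1 c2
      exact integrable_mul_of_hasCompactSupport (c1.mul c2) (hη.contDiff.continuous.pow _)
        (hη.hasCompactSupport_pow (by omega))
    · have e3 : (R ^ scalingBeta p q * v (R • x)) ^ p * (R ^ scalingAlpha p q * u (R • x)) ^ s =
          R ^ (scalingAlpha p q * s + scalingBeta p q * p) * (v (R • x) ^ p * u (R • x) ^ s) := by
        rw [Real.mul_rpow (by positivity) (h.v_pos _).le,
          Real.mul_rpow (by positivity) (h.u_pos _).le, ← Real.rpow_mul hR0.le,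
          ← Real.rpow_mul hR0.le, Real.rpow_add hR0]
        ring
      simp only [e3, mul_assoc]
      refine mul_le_mul_of_nonneg_left ?_ (by positivity)
      by_cases hx : R • x ∈ B
      · have hx1 : x ∈ B := by
          rw [hB, mem_closedBall_zero_iff] at hx ⊢
          rw [norm_smul, Real.norm_of_nonneg hR0.le] at hx
          nlinarith [norm_nonneg x]
        rw [hF, indicator_of_mem hx, hη.eq_one x hx1, one_pow, mul_one]
      · rw [hF, indicator_of_notMem hx]
        have := (hpos (R • x)).le
        rw [← mul_assoc]
        exact mul_nonneg this (pow_nonneg (hη.nonneg x) _)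
  have ht := (tendsto_rpow_atTop hδ0).atTop_mul_const hFpos
  obtain ⟨R, hR, hR1⟩ := ((ht.eventually_gt_atTop C).and (eventually_ge_atTop 1)).exists
  exact absurd (hbound R hR1) (not_le.2 hR)

end LaneEmden

theorem mainTheorem8 (d : ℕ) (hd : 2 ≤ d) (p q : ℝ) (hq : 1 < q) (hpq : q ≤ p) :
    ∃ x₀ : ℝ, IsGreatest {x : ℝ | LaneEmden.quarticH p q x = 0} x₀ ∧
      ((d : ℝ) < 2 + 2 * x₀ →
        ¬ ∃ u v : EuclideanSpace ℝ (Fin d) → ℝ,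
            LaneEmden.IsClassicalSolution p q u v ∧
            (∀ x, 0 < u x) ∧ (∀ x, 0 < v x) ∧
            LaneEmden.IsStableOn p q u v Set.univ) := by
  have hp : 1 < p := hq.trans_le hpq
  obtain ⟨x₀, hx₀, hnear⟩ := LaneEmden.exists_isGreatest_quarticH hq hp
  refine ⟨x₀, hx₀, fun hdim => ?_⟩
  rintro ⟨u, v, hsol, hu, hv, hstab⟩
  obtain ⟨φ, ψ, h⟩ := hsol.exists_isPositiveStable hu hv hstab
  obtain ⟨x, hdx, hx, hHx⟩ := hnear (((d : ℝ) - 2) / 2) (by linarith)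
  have hpq1 : 0 < p * q - 1 := by nlinarith
  have hα : 0 < LaneEmden.scalingAlpha p q := by unfold LaneEmden.scalingAlpha; positivity
  have hβ : 0 < LaneEmden.scalingBeta p q := by unfold LaneEmden.scalingBeta; positivity
  have hαβ : LaneEmden.scalingAlpha p q * (q + 1) = LaneEmden.scalingBeta p q * (p + 1) := by
    unfold LaneEmden.scalingAlpha LaneEmden.scalingBeta; ring
  have hβp : LaneEmden.scalingBeta p q * p = LaneEmden.scalingAlpha p q + 2 := by
    unfold LaneEmden.scalingAlpha LaneEmden.scalingBeta
    rw [div_add' _ _ _ hpq1.ne', div_mul_eq_mul_div]; congr 1; ring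
  rw [LaneEmden.quarticH_eq] at hHx
  -- With these exponents the absorption condition is `H(x) < 0`, and `βp = α + 2` gives `αs + βp =
  -- 2x + 2 > d`.
  refine LaneEmden.IsPositiveStable.false_of_exponent hd (s := 2 * x / LaneEmden.scalingAlpha p q - 1)
    (t := 2 * x / LaneEmden.scalingBeta p q - 1) hq hpq ?_ ?_ ?_ ?_ h
  · rw [le_sub_iff_add_le, le_div_iff₀ hα]; linarith
  · rw [sub_add_cancel, sub_add_cancel, div_mul_eq_mul_div, div_mul_eq_mul_div,
      div_eq_div_iff hβ.ne' hα.ne']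
    linear_combination 2 * x * hαβ
  · generalize LaneEmden.scalingAlpha p q = α at *
    generalize LaneEmden.scalingBeta p q = β at *
    have e1 : (2 * x / α - 1 + 1) ^ 2 * (2 * x / β - 1 + 1) ^ 2 = 16 * x ^ 4 / (α * β) ^ 2 := by
      field_simp; ring
    have e2 : 16 * (p * q) * ((2 * x / α - 1) * (2 * x / β - 1)) =
        16 * (p * q * α * β * ((2 * x - α) * (2 * x - β))) / (α * β) ^ 2 := by
      field_simp
    rw [e1, e2]
    gcongr
    linarith
  · rw [hβp, mul_sub, mul_div_cancel₀ _ hα.ne']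
    linarith
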